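/- \textbf{Setting.} Let $(\mathcal X,d)$ be a nonempty finite metric space and let $\lambda_x>0$ for every $x\in\mathcal X$. Requests arrive at the points of $\mathcal X$ in the distributed Poisson arrival model: starting from time $0$, the waiting times between consecutive requests at the point $x$ are exponentially distributed with parameter $\lambda_x$, and all waiting times, at all points, are mutually independent. For an even integer $m$, let $\sigma$ be the random sequence of the first $m$ requests arriving in $\mathcal X$, where the request $r$ has location $\ell(r)$ and arrival time $t(r)$. A feasible solution for $\sigma$ is a perfect matching $M$ of the $m$ requests with service times $s(r)\ge t(r)$ such that $s(r)=s(r')$ whenever $(r,r')\in M$. Its cost is the delay cost plus the connection cost, $$\sum_{r\in\sigma}(s(r)-t(r))+\sum_{(r,r')\in M}d(\ell(r),\ell(r')).$$ Let $\mathrm{OPT}(\sigma)$ be the minimum cost of a feasible solution. The algorithm Greedy matches two pending requests $r,r'$ as soon as the time $t$ satisfies $(t-t(r))+(t-t(r'))\ge d(\ell(r),\ell(r'))$; ties are broken arbitrarily. Let $\mathrm{Greedy}(\sigma)$ be the cost of the solution that it produces. \textbf{Theorem.} For every such metric space, all such rates $\lambda_x$, and every way of breaking ties, Greedy achieves a ratio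 of expectations of $16/(1-e^{-2})$: for every even $m\ge 2$ we have $0<\mathbb E^m_\sigma[\mathrm{OPT}(\sigma)]<\infty$ and $\mathbb E^m_\sigma[\mathrm{Greedy}(\sigma)]<\infty$, and $$\limsup_{\substack{m\to\infty\\ m\text{ even}}}\ \frac{\mathbb E^m_\sigma[\mathrm{Greedy}(\sigma)]}{\mathbb E^m_\sigma[\mathrm{OPT}(\sigma)]}\ \le\ \frac{16}{1-e^{-2}}.$$ -/

import Mathlib

open MeasureTheory ProbabilityTheory Filter
open scoped ENNReal

namespace MPMD

noncomputable section

/-! ### Deterministic instances, solutions, and the greedy algorithm -/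

/-- A finite sequence of `m` requests in `X`, each with a location and an arrival time. -/
structure RequestSeq (X : Type*) (m : ℕ) where
  loc : Fin m → X
  arr : Fin m → ℝ

/-- A candidate solution: the partner of each request and the moment at which it is matched. -/
structure Solution (m : ℕ) where
  partner : Fin m → Fin m
  time : Fin m → ℝ

/-- `S` is a feasible solution: the pairs form a perfect matching, no request is matched before
it arrives, and the two requests of a pair are matched at the same moment. -/
structure IsFeasible {X : Type*} {m : ℕ} (σ : RequestSeq X m) (S : Solution m) : Prop where
  partner_partner : ∀ i, S.partner (S.partner i) = i
  partner_ne : ∀ i, S.partner i ≠ i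
  arr_le_time : ∀ i, σ.arr i ≤ S.time i
  time_partner : ∀ i, S.time (S.partner i) = S.time i

/-- Delay cost: the total waiting time of the requests. -/
def delayCost {X : Type*} {m : ℕ} (σ : RequestSeq X m) (S : Solution m) : ℝ :=
  ∑ i, (S.time i - σ.arr i)

/-- Connection cost: the total distance between matched requests. The sum over requests counts
every pair twice. -/
def connectionCost {X : Type*} [MetricSpace X] {m : ℕ} (σ : RequestSeq X m)
    (S : Solution m) : ℝ :=
  (∑ i, dist (σ.loc i) (σ.loc (S.partner i))) / 2

/-- Total cost of a solution. -/
def cost {X : Type*} [MetricSpace X] {m : ℕ} (σ : RequestSeq X m) (S : Solution m) : ℝ :=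
  delayCost σ S + connectionCost σ S

/-- The optimal offline cost: the minimum cost of a feasible solution. -/
def opt {X : Type*} [MetricSpace X] {m : ℕ} (σ : RequestSeq X m) : ℝ :=
  sInf {c | ∃ S : Solution m, IsFeasible σ S ∧ cost σ S = c}

/-- `S` is an output of Greedy on `σ`, under some way of breaking ties: every pair is matched at a
time when the sum of the two waiting times has reached the distance, and at no time `t` are there
two distinct requests that have arrived, are left unmatched by the decisions taken up to and
including time `t`, and whose waiting times sum up to at least their distance. -/
structure IsGreedy {X : Type*} [MetricSpace X] {m : ℕ} (σ : RequestSeq X m)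
    (S : Solution m) : Prop where
  feasible : IsFeasible σ S
  reached : ∀ i, dist (σ.loc i) (σ.loc (S.partner i)) ≤
    (S.time i - σ.arr i) + (S.time i - σ.arr (S.partner i))
  prompt : ∀ i j t, i ≠ j → σ.arr i ≤ t → σ.arr j ≤ t → t < S.time i → t < S.time j →
    (t - σ.arr i) + (t - σ.arr j) < dist (σ.loc i) (σ.loc j)

/-- Greedy is well defined: it has an output on every sequence of even length. -/
theorem exists_isGreedy {X : Type*} [MetricSpace X] {m : ℕ} (hm : Even m)
    (σ : RequestSeq X m) : ∃ S : Solution m, IsGreedy σ S := by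
  suffices H : ∀ k : ℕ, ∀ s : Finset (Fin m), s.card = 2 * k →
      ∃ p : Fin m → Fin m, ∃ u : Fin m → ℝ,
        (∀ i ∈ s, p i ∈ s ∧ p (p i) = i ∧ p i ≠ i ∧ σ.arr i ≤ u i ∧ u (p i) = u i ∧
          dist (σ.loc i) (σ.loc (p i)) ≤ (u i - σ.arr i) + (u i - σ.arr (p i))) ∧
        ∀ i ∈ s, ∀ j ∈ s, ∀ t, i ≠ j → σ.arr i ≤ t → σ.arr j ≤ t → t < u i → t < u j →
          (t - σ.arr i) + (t - σ.arr j) < dist (σ.loc i) (σ.loc j) by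
    obtain ⟨k, hk⟩ := hm
    obtain ⟨p, u, h1, h2⟩ := H k Finset.univ (by rw [Finset.card_univ, Fintype.card_fin]; omega)
    have h1' := fun i => h1 i (Finset.mem_univ i)
    exact ⟨⟨p, u⟩, ⟨fun i => (h1' i).2.1, fun i => (h1' i).2.2.1, fun i => (h1' i).2.2.2.1,
      fun i => (h1' i).2.2.2.2.1⟩, fun i => (h1' i).2.2.2.2.2,
      fun i j => h2 i (Finset.mem_univ i) j (Finset.mem_univ j)⟩
  intro k
  induction k with
  | zero =>
    intro s hs
    have : s = ∅ := by simpa using hs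
    subst this
    exact ⟨id, σ.arr, by simp, by simp⟩
  | succ k ih =>
    intro s hs
    let f : Fin m × Fin m → ℝ := fun q => max (max (σ.arr q.1) (σ.arr q.2))
      ((σ.arr q.1 + σ.arr q.2 + dist (σ.loc q.1) (σ.loc q.2)) / 2)
    have hne : s.offDiag.Nonempty := by
      obtain ⟨a, ha, b, hb, hab⟩ := Finset.one_lt_card.1 (show 1 < s.card by omega)
      exact ⟨(a, b), by simp [ha, hb, hab]⟩
    obtain ⟨⟨a, b⟩, hq, hmin⟩ := Finset.exists_min_image s.offDiag f hne
    rw [Finset.mem_offDiag] at hq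
    obtain ⟨ha, hb, hab⟩ := hq
    simp only at ha hb hab
    have hfa : σ.arr a ≤ f (a, b) := le_trans (le_max_left _ _) (le_max_left _ _)
    have hfb : σ.arr b ≤ f (a, b) := le_trans (le_max_right _ _) (le_max_left _ _)
    have hfd : (σ.arr a + σ.arr b + dist (σ.loc a) (σ.loc b)) / 2 ≤ f (a, b) := le_max_right _ _
    obtain ⟨p, u, h1, h2⟩ := ih ((s.erase a).erase b) (by
      rw [Finset.card_erase_of_mem (by simp [hb, hab.symm]), Finset.card_erase_of_mem ha]; omega)
    refine ⟨fun i => if i = a then b else if i = b then a else p i,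
      fun i => if i = a ∨ i = b then f (a, b) else u i, ?_, ?_⟩
    · intro i hi
      by_cases hia : i = a
      · subst hia
        simp only [true_or, if_true, hab.symm, if_false, or_true]
        exact ⟨hb, trivial, hab.symm, hfa, trivial, by linarith⟩
      by_cases hib : i = b
      · subst hib
        simp only [or_true, if_true, hia, if_false, true_or]
        exact ⟨ha, trivial, hab, hfb, trivial, by rw [dist_comm]; linarith⟩
      · have hi' : i ∈ (s.erase a).erase b := by simp [hi, hia, hib]
        obtain ⟨g1, g2, g3, g4, g5, g6⟩ := h1 i hi'
        simp only [Finset.mem_erase] at g1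
        simp only [hia, hib, if_false, or_self, g1.1, g1.2.1]
        exact ⟨g1.2.2, g2, g3, g4, g5, g6⟩
    · intro i hi j hj t hij hti htj hui huj
      by_contra! hcon
      beta_reduce at hui huj
      have hle : f (a, b) ≤ t := (hmin (i, j) (by simp [hi, hj, hij])).trans
        (max_le (max_le hti htj) (by simp only; linarith))
      have hi2 : ¬(i = a ∨ i = b) := fun h => by rw [if_pos h] at hui; linarith
      have hj2 : ¬(j = a ∨ j = b) := fun h => by rw [if_pos h] at huj; linarith
      rw [if_neg hi2] at hui
      rw [if_neg hj2] at huj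
      have := h2 i (by simp_all) j (by simp_all) t hij hti htj hui huj
      linarith

/-! ### The distributed Poisson arrival model -/

/-- The arrival time of request number `k` (counted from `0`) at the point `x`, when `w x j` is the
waiting time between the arrivals number `j - 1` and `j` at `x` (from time `0`, if `j = 0`). -/
def pointArrival {X : Type*} (w : X → ℕ → ℝ) (x : X) (k : ℕ) : ℝ :=
  ∑ j ∈ Finset.range (k + 1), w x j

/-- A point at which `f` is minimal. -/
def argmin {X : Type*} [Finite X] [Nonempty X] (f : X → ℝ) : X :=
  (Finite.exists_min f).choose

open Classical in
/-- `counts w n x` is the number of requests at `x` among the first `n` requests in the whole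
space: the next request is always the earliest among the next requests at the single points. -/
def counts {X : Type*} [Finite X] [Nonempty X] (w : X → ℕ → ℝ) : ℕ → X → ℕ
  | 0 => fun _ => 0
  | n + 1 =>
    let x := argmin fun y => pointArrival w y (counts w n y)
    Function.update (counts w n) x (counts w n x + 1)

/-- The location of request number `n` (counted from `0`) in the whole space, in order of
arrival. -/
def nthLoc {X : Type*} [Finite X] [Nonempty X] (w : X → ℕ → ℝ) (n : ℕ) : X :=
  argmin fun y => pointArrival w y (counts w n y)

/-- The arrival time of request number `n` (counted from `0`) in the whole space. -/
def nthArr {X : Type*} [Finite X] [Nonempty X] (w : X → ℕ → ℝ) (n : ℕ) : ℝ :=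
  pointArrival w (nthLoc w n) (counts w n (nthLoc w n))

/-- The sequence of the first `m` requests in the whole space, in order of arrival. -/
def firstRequests {X : Type*} [Finite X] [Nonempty X] (w : X → ℕ → ℝ) (m : ℕ) :
    RequestSeq X m where
  loc i := nthLoc w i
  arr i := nthArr w i

/-- The random waiting times `W x j` (`j`-th waiting time at the point `x`) follow the distributed
Poisson arrival model with rates `rate x`: they are mutually independent, and those at `x` are
exponential with parameter `rate x`. -/
structure IsPoissonModel {X Ω : Type*} [MeasurableSpace Ω] (P : Measure Ω) (rate : X → ℝ)
    (W : X → ℕ → Ω → ℝ) : Prop where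
  rate_pos : ∀ x, 0 < rate x
  measurable : ∀ x j, Measurable (W x j)
  law : ∀ x j, P.map (W x j) = expMeasure (rate x)
  indep : iIndepFun (fun p : X × ℕ => W p.1 p.2) P

/-- The random request sequence of length `m`: the first `m` requests. -/
def randomRequests {X Ω : Type*} [Finite X] [Nonempty X] (W : X → ℕ → Ω → ℝ) (m : ℕ) (ω : Ω) :
    RequestSeq X m :=
  firstRequests (fun x j => W x j ω) m

/-- Expected cost of the solutions `S ω` on the random request sequence of length `m`. -/
def expCost {X Ω : Type*} [MetricSpace X] [Finite X] [Nonempty X] [MeasurableSpace Ω]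
    (P : Measure Ω) (W : X → ℕ → Ω → ℝ) {m : ℕ} (S : Ω → Solution m) : ℝ≥0∞ :=
  ∫⁻ ω, ENNReal.ofReal (cost (randomRequests W m ω) (S ω)) ∂P

/-- Expected optimal offline cost on the random request sequence of length `m`. -/
def expOpt {X Ω : Type*} [MetricSpace X] [Finite X] [Nonempty X] [MeasurableSpace Ω]
    (P : Measure Ω) (W : X → ℕ → Ω → ℝ) (m : ℕ) : ℝ≥0∞ :=
  ∫⁻ ω, ENNReal.ofReal (opt (randomRequests W m ω)) ∂P

end

end MPMD

/-! Write λ for the rates and Λ for their sum. Let I_x(a) = ∑_y λ_y max(a - d(x,y), 0): the expected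
number of requests in the space-time cone that a request at `x` opens, cut off at a time `a` later.
Choose ρ_x with I_x(ρ_x) = 1/2 and let R = ∑_x (λ_x/Λ) ρ_x be the mean radius at a random request.
Both expected costs are compared with m R.

Greedy: pairs are matched once their waiting times reach their distance, so the connection cost is
at most the delay cost. A request at `x` pending for longer than `a` has seen no later request in
its cone (`IsGreedy.time_le_arr`), and a Poisson process avoids the cone with probability at most
exp(-I_x(a)) (`measure_quiet_le`). Integrating over `a` bounds the expected delay by ρ_x (1 + 2
exp(-1/2)) (`lintegral_exp_neg_intensity_le`). Hence Greedy costs at most 2 (1 + 2 exp(-1/2)) m R +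
O(1), where O(1) pays for the requests still pending after the last arrival.

OPT: twice the cost of a matching dominates the sum, over all requests, of the space-time distance
to the partner. The radius of a request exceeds this distance by at most the sum of its positive
excesses over the distances to all other requests (`sum_radius_le_opt`). The total expected excess
is at most m R / 2 (`sum_lintegral_overlap_le`), so m R ≤ 2 E[OPT] + m R / 2, that is, E[OPT] ≥ m R
/ 4.

The limiting ratio is at most 8 (1 + 2 exp(-1/2)) < 17.71, while 16 / (1 - exp(-2)) > 18.50. All
probability rests on `lintegral_step`: after the first request the process starts afresh,
independently of that request's place and time. -/

namespace MPMD

/-! ### Deterministic bounds for OPT and Greedy -/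

section Deterministic

variable {X : Type*} [MetricSpace X] {m : ℕ} {σ : RequestSeq X m} {S : Solution m}

/-- The distance between two requests in space-time. -/
noncomputable def gap (σ : RequestSeq X m) (i j : Fin m) : ℝ :=
  |σ.arr j - σ.arr i| + dist (σ.loc i) (σ.loc j)

lemma gap_comm (σ : RequestSeq X m) (i j : Fin m) : gap σ i j = gap σ j i := by
  simp only [gap, dist_comm, abs_sub_comm]

omit [MetricSpace X] in
lemma IsFeasible.sum_partner (hS : IsFeasible σ S) (f : Fin m → ℝ) :
    ∑ i, f (S.partner i) = ∑ i, f i :=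
  (Function.Involutive.bijective hS.partner_partner).sum_comp f

lemma IsFeasible.cost_nonneg (hS : IsFeasible σ S) : 0 ≤ cost σ S :=
  add_nonneg (Finset.sum_nonneg fun i _ => sub_nonneg.2 (hS.arr_le_time i))
    (div_nonneg (Finset.sum_nonneg fun _ _ => dist_nonneg) zero_le_two)

lemma opt_le_cost (hS : IsFeasible σ S) : opt σ ≤ cost σ S :=
  csInf_le ⟨0, by rintro c ⟨S', hS', rfl⟩; exact hS'.cost_nonneg⟩ ⟨S, hS, rfl⟩

/-- Partners are served simultaneously, so their arrival times differ by at most the sum of their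
delays. The factor 2 arises because each pair is counted from both ends. -/
lemma IsFeasible.sum_gap_le (hS : IsFeasible σ S) :
    ∑ i, gap σ i (S.partner i) ≤ 2 * cost σ S := by
  have h1 : ∀ i, |σ.arr (S.partner i) - σ.arr i| ≤
      (S.time i - σ.arr i) + (S.time (S.partner i) - σ.arr (S.partner i)) := by
    intro i
    have a1 := hS.arr_le_time i
    have a2 := hS.arr_le_time (S.partner i)
    have a3 := hS.time_partner i
    rw [abs_le]
    constructor <;> linarith
  have h2 := Finset.sum_le_sum fun i (_ : i ∈ Finset.univ) => h1 i
  rw [Finset.sum_add_distrib, hS.sum_partner fun i => S.time i - σ.arr i] at h2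
  simp only [gap, Finset.sum_add_distrib, cost, delayCost, connectionCost]
  linarith

/-- The partner is unknown, so the excess of the radius over the distance to it is replaced by the
sum of the excesses over all other requests. That bound does not depend on the matching. -/
lemma IsFeasible.sum_radius_le (hS : IsFeasible σ S) (ρ : X → ℝ) :
    ∑ i, ρ (σ.loc i) ≤ 2 * cost σ S + ∑ i, ∑ j ∈ Finset.Ioi i,
      (max (ρ (σ.loc i) - gap σ i j) 0 + max (ρ (σ.loc j) - gap σ i j) 0) := by
  have key : ∀ i, ρ (σ.loc i) ≤ gap σ i (S.partner i) +
      (∑ j ∈ Finset.Ioi i, max (ρ (σ.loc i) - gap σ i j) 0 +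
        ∑ j ∈ Finset.Iio i, max (ρ (σ.loc i) - gap σ i j) 0) := by
    intro i
    have hle : max (ρ (σ.loc i) - gap σ i (S.partner i)) 0 ≤
      ∑ j ∈ Finset.Ioi i, max (ρ (σ.loc i) - gap σ i j) 0 +
        ∑ j ∈ Finset.Iio i, max (ρ (σ.loc i) - gap σ i j) 0 := by
      have n1 : ∀ s : Finset (Fin m), 0 ≤ ∑ j ∈ s, max (ρ (σ.loc i) - gap σ i j) 0 :=
        fun s => Finset.sum_nonneg fun _ _ => le_max_right _ _
      rcases lt_or_gt_of_ne (hS.partner_ne i) with h | h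
      · have := Finset.single_le_sum (f := fun j => max (ρ (σ.loc i) - gap σ i j) 0)
          (fun _ _ => le_max_right _ _) (Finset.mem_Iio.2 h)
        linarith [n1 (Finset.Ioi i)]
      · have := Finset.single_le_sum (f := fun j => max (ρ (σ.loc i) - gap σ i j) 0)
          (fun _ _ => le_max_right _ _) (Finset.mem_Ioi.2 h)
        linarith [n1 (Finset.Iio i)]
    linarith [le_max_left (ρ (σ.loc i) - gap σ i (S.partner i)) 0]
  have h2 := Finset.sum_le_sum fun i (_ : i ∈ Finset.univ) => key i
  rw [Finset.sum_add_distrib, Finset.sum_add_distrib] at h2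
  -- Each pair is charged to its earlier request, so that later only the future of a request is
  -- needed, which is independent of its location.
  have hswap : ∑ i, ∑ j ∈ Finset.Iio i, max (ρ (σ.loc i) - gap σ i j) 0 =
      ∑ i, ∑ j ∈ Finset.Ioi i, max (ρ (σ.loc j) - gap σ i j) 0 := by
    rw [Finset.sum_comm' (t' := Finset.univ) (s' := fun i => Finset.Ioi i) (by simp)]
    exact Finset.sum_congr rfl fun i _ => Finset.sum_congr rfl fun j _ => by rw [gap_comm]
  rw [hswap] at h2
  simp only [Finset.sum_add_distrib]
  linarith [hS.sum_gap_le]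

lemma opt_nonneg (σ : RequestSeq X m) : 0 ≤ opt σ :=
  Real.sInf_nonneg (by rintro c ⟨S', hS', rfl⟩; exact hS'.cost_nonneg)

lemma sum_radius_le_opt (hm : Even m) (σ : RequestSeq X m) (ρ : X → ℝ) :
    ∑ i, ρ (σ.loc i) ≤ 2 * opt σ + ∑ i, ∑ j ∈ Finset.Ioi i,
      (max (ρ (σ.loc i) - gap σ i j) 0 + max (ρ (σ.loc j) - gap σ i j) 0) := by
  obtain ⟨S, hS⟩ := exists_isGreedy hm σ
  have : (∑ i, ρ (σ.loc i) - ∑ i, ∑ j ∈ Finset.Ioi i,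
      (max (ρ (σ.loc i) - gap σ i j) 0 + max (ρ (σ.loc j) - gap σ i j) 0)) / 2 ≤ opt σ :=
    -- The Greedy solution shows that the set of costs is nonempty, so that `sInf` is not the
    -- default value 0.
    le_csInf ⟨_, S, hS.feasible, rfl⟩ (by
      rintro c ⟨S', hS', rfl⟩
      linarith [hS'.sum_radius_le ρ])
  linarith

lemma IsGreedy.cost_le (hS : IsGreedy σ S) : cost σ S ≤ 2 * delayCost σ S := by
  have h2 := Finset.sum_le_sum fun i (_ : i ∈ Finset.univ) => hS.reached i
  have h3 := hS.feasible.sum_partner fun i => S.time i - σ.arr i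
  simp only [hS.feasible.time_partner] at h3
  rw [Finset.sum_add_distrib, h3] at h2
  simp only [cost, connectionCost, delayCost] at *
  linarith

/-- A pending request is matched as soon as a request arrives at a distance smaller than its
waiting time. -/
lemma IsGreedy.time_le_arr (hS : IsGreedy σ S) (hinj : Function.Injective σ.arr) {i j : Fin m}
    (h : dist (σ.loc i) (σ.loc j) < σ.arr j - σ.arr i) : S.time i ≤ σ.arr j := by
  by_contra! hlt
  have hij : i ≠ j := by
    rintro rfl
    simp at h
  have hd := dist_nonneg (x := σ.loc i) (y := σ.loc j)
  have hj := hS.feasible.arr_le_time j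
  rcases hj.lt_or_eq with hj | hj
  · have := hS.prompt i j (σ.arr j) hij (by linarith) le_rfl hlt hj
    linarith
  -- Here `j` is matched on arrival, with some `p ≠ i` that was already waiting. By the triangle
  -- inequality through `j`, the pair `i`, `p` had reached its distance strictly before `j` arrived,
  -- against promptness. Distinct arrival times leave room for such a time `t`.
  have hr := hS.reached j
  have hp := hS.feasible.arr_le_time (S.partner j)
  rw [hS.feasible.time_partner] at hp
  rw [← hj] at hr hp
  have hpj := hinj.ne (hS.feasible.partner_ne j)
  have hip : i ≠ S.partner j := by
    rintro rfl
    rw [hS.feasible.time_partner] at hlt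
    linarith
  have htri := dist_triangle_right (σ.loc i) (σ.loc (S.partner j)) (σ.loc j)
  rw [dist_comm (σ.loc j)] at hr
  obtain ⟨t, ht1, ht2⟩ := exists_between (show max (max (σ.arr i) (σ.arr (S.partner j)))
    ((σ.arr i + σ.arr j + dist (σ.loc i) (σ.loc j)) / 2) < σ.arr j from
      max_lt (max_lt (by linarith) (lt_of_le_of_ne hp hpj)) (by linarith))
  simp only [max_lt_iff] at ht1
  have hpr := hS.prompt i (S.partner j) t hip ht1.1.1.le ht1.1.2.le (by linarith)
    (by rw [hS.feasible.time_partner]; linarith)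
  rw [dist_comm (σ.loc (S.partner j))] at htri
  rw [dist_comm (σ.loc (S.partner j))] at hr
  linarith

/-- At most one request per point is pending after the last arrival, and it is soon matched. -/
lemma IsGreedy.delayCost_le [Fintype X] (hS : IsGreedy σ S) {l : Fin m}
    (hl : ∀ i, σ.arr i ≤ σ.arr l) {D : ℝ} (hD : ∀ x y : X, dist x y ≤ D) :
    delayCost σ S ≤ ∑ i, (min (S.time i) (σ.arr l) - σ.arr i) + Fintype.card X * D := by
  have hD0 : 0 ≤ D := dist_nonneg.trans (hD (σ.loc l) (σ.loc l))
  set K := Finset.univ.filter fun i => σ.arr l < S.time i with hK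
  -- Two pending requests at one point have distance 0 and would be matched at once.
  have hcard : K.card ≤ Fintype.card X := by
    refine Finset.card_le_card_of_injOn σ.loc (fun _ _ => Finset.mem_univ _) ?_
    intro i hi j hj hij
    by_contra hne
    simp only [hK, Finset.coe_filter, Finset.mem_univ, true_and, Set.mem_ofPred_eq] at hi hj
    have := hS.prompt i j _ hne (hl i) (hl j) hi hj
    rw [hij, dist_self] at this
    linarith [hl i, hl j]
  have hex : ∀ i, S.time i ≤ σ.arr l + D := by
    intro i
    by_contra! h
    have := hS.prompt i (S.partner i) _ (hS.feasible.partner_ne i).symm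
      (by linarith [hl i]) (by linarith [hl (S.partner i)]) h
      (by rw [hS.feasible.time_partner]; exact h)
    linarith [hl i, hl (S.partner i), hD (σ.loc i) (σ.loc (S.partner i))]
  have hi : ∀ i, S.time i - σ.arr i ≤
      (min (S.time i) (σ.arr l) - σ.arr i) + if i ∈ K then D else 0 := by
    intro i
    by_cases h : σ.arr l < S.time i
    · simp only [hK, Finset.mem_filter, Finset.mem_univ, h, true_and, if_true,
        min_eq_right h.le]
      linarith [hex i]
    · simp only [hK, Finset.mem_filter, Finset.mem_univ, h, true_and, if_false]
      rw [min_eq_left (not_lt.1 h), add_zero]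
  have h2 := Finset.sum_le_sum fun i (_ : i ∈ Finset.univ) => hi i
  rw [Finset.sum_add_distrib] at h2
  refine h2.trans (by
    gcongr
    rw [Finset.sum_ite_mem, Finset.univ_inter, Finset.sum_const, nsmul_eq_mul]
    gcongr)

end Deterministic
-- Restarting the arrival process after its first request
section Residual

variable {X : Type*} [Finite X] [Nonempty X]

lemma argmin_le (f : X → ℝ) (y : X) : f (argmin f) ≤ f y := (Finite.exists_min f).choose_spec y

/-- The choice depends only on the set of minimizers, so even ties are broken identically. -/
lemma argmin_congr {f g : X → ℝ} (h : ∀ x y, f x ≤ f y ↔ g x ≤ g y) : argmin f = argmin g := by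
  have : (fun x => ∀ y, f x ≤ f y) = fun x => ∀ y, g x ≤ g y := by
    funext x
    exact propext (forall_congr' fun y => h x y)
  unfold argmin
  congr 1

/-- The location of the first request. -/
noncomputable def firstLoc (w : X → ℕ → ℝ) : X := nthLoc w 0

/-- The arrival time of the first request. -/
noncomputable def firstArr (w : X → ℕ → ℝ) : ℝ := nthArr w 0

lemma firstLoc_eq (w : X → ℕ → ℝ) : firstLoc w = argmin fun y => w y 0 := by
  simp [firstLoc, nthLoc, counts, pointArrival]

lemma firstArr_eq (w : X → ℕ → ℝ) : firstArr w = w (firstLoc w) 0 := by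
  simp [firstArr, firstLoc, nthArr, counts, pointArrival]

open Classical in
/-- The waiting times at all points after time `t`, at which a request has arrived at `x` and
before which there is no other one. -/
noncomputable def residual (x : X) (t : ℝ) (w : X → ℕ → ℝ) : X → ℕ → ℝ := fun y =>
  if y = x then fun j => w y (j + 1) else Function.update (w y) 0 (w y 0 - t)

/-- The waiting times at all points after the first request. -/
noncomputable def step (w : X → ℕ → ℝ) : X → ℕ → ℝ := residual (firstLoc w) (firstArr w) w

open Classical in
lemma pointArrival_step (w : X → ℕ → ℝ) (y : X) (i : ℕ) :
    pointArrival (step w) y i =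
      pointArrival w y (i + if y = firstLoc w then 1 else 0) - firstArr w := by
  by_cases h : y = firstLoc w
  · simp only [pointArrival, step, residual, h, if_true]
    rw [Finset.sum_range_succ' _ (i + 1), firstArr_eq]
    ring
  · simp only [pointArrival, step, residual, h, if_false, add_zero]
    rw [Finset.sum_range_succ', Finset.sum_range_succ']
    simp
    ring

open Classical in
lemma counts_succ (w : X → ℕ → ℝ) (n : ℕ) (y : X) :
    counts w (n + 1) y = counts w n y + if y = nthLoc w n then 1 else 0 := by
  change Function.update (counts w n) (nthLoc w n) (counts w n (nthLoc w n) + 1) y = _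
  rw [Function.update_apply]
  split_ifs with h <;> simp [h]

open Classical in
-- Restarting subtracts one constant from all candidate arrival times, which does not change the
-- minimizer. The identity for `counts` is a hypothesis because its inductive proof in
-- `counts_succ_eq` uses this lemma.
lemma nthLoc_succ_of_counts {w : X → ℕ → ℝ} {n : ℕ} (h : ∀ y,
    counts w (n + 1) y = counts (step w) n y + if y = firstLoc w then 1 else 0) :
    nthLoc w (n + 1) = nthLoc (step w) n := by
  refine argmin_congr fun x y => ?_
  rw [pointArrival_step, pointArrival_step, ← h, ← h]
  simp

open Classical in
lemma counts_succ_eq (w : X → ℕ → ℝ) (n : ℕ) (y : X) :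
    counts w (n + 1) y = counts (step w) n y + if y = firstLoc w then 1 else 0 := by
  induction n generalizing y with
  | zero => rw [counts_succ]; rfl
  | succ n ih =>
    rw [counts_succ, counts_succ (step w), nthLoc_succ_of_counts ih, ih]
    ring

lemma nthLoc_succ (w : X → ℕ → ℝ) (n : ℕ) : nthLoc w (n + 1) = nthLoc (step w) n :=
  nthLoc_succ_of_counts (counts_succ_eq w n)

lemma nthArr_succ (w : X → ℕ → ℝ) (n : ℕ) :
    nthArr w (n + 1) = firstArr w + nthArr (step w) n := by
  classical
  rw [nthArr, nthArr, nthLoc_succ, pointArrival_step, counts_succ_eq]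
  ring

lemma nthLoc_add (w : X → ℕ → ℝ) (k n : ℕ) : nthLoc w (k + n) = nthLoc (step^[k] w) n := by
  induction k generalizing w with
  | zero => simp
  | succ k ih => rw [show k + 1 + n = k + n + 1 by ring, nthLoc_succ, ih, Function.iterate_succ_apply]

lemma nthLoc_eq (w : X → ℕ → ℝ) (k : ℕ) : nthLoc w k = firstLoc (step^[k] w) :=
  nthLoc_add w k 0

lemma nthArr_add (w : X → ℕ → ℝ) (k n : ℕ) :
    nthArr w (k + 1 + n) = nthArr w k + nthArr (step^[k + 1] w) n := by
  induction k generalizing w with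
  | zero => rw [zero_add, add_comm 1 n, nthArr_succ]; rfl
  | succ k ih =>
    rw [show k + 1 + 1 + n = k + 1 + n + 1 by ring, nthArr_succ, ih, nthArr_succ w k, add_assoc]
    rfl

end Residual
-- Sequences of independent exponential waiting times
section WaitingTimes

variable {r : ℝ} [hr : Fact (0 < r)]

instance : IsProbabilityMeasure (expMeasure r) := isProbabilityMeasure_expMeasure hr.out

omit hr in
lemma lintegral_expMeasure (f : ℝ → ℝ≥0∞) :
    ∫⁻ t, f t ∂expMeasure r =
      ∫⁻ t in Set.Ioi 0, ENNReal.ofReal (r * Real.exp (-(r * t))) * f t := by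
  have hm : Measurable (gammaPDF 1 r) := by
    unfold gammaPDF; exact (measurable_gammaPDFReal 1 r).ennreal_ofReal
  have h0 : ∀ t, gammaPDF 1 r t = exponentialPDF r t := fun _ => rfl
  rw [expMeasure, gammaMeasure, lintegral_withDensity_eq_lintegral_mul_non_measurable _ hm
    (ae_of_all _ fun t => by simp [gammaPDF]), ← setLIntegral_eq_of_support_subset (s := Set.Ici 0),
    setLIntegral_congr Ioi_ae_eq_Ici.symm]
  · refine setLIntegral_congr_fun measurableSet_Ioi fun t ht => ?_
    simp only [Pi.mul_apply]
    rw [h0, exponentialPDF_of_nonneg (le_of_lt ht)]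
  · intro t ht
    by_contra h
    simp only [Set.mem_Ici, not_le] at h
    apply ht
    simp only [Pi.mul_apply]
    rw [h0, exponentialPDF_of_neg h, zero_mul]

/-- The sequence with first term `t`, followed by the sequence `v`. -/
def consSeq (t : ℝ) (v : ℕ → ℝ) : ℕ → ℝ
  | 0 => t
  | n + 1 => v n

lemma measurable_consSeq : Measurable fun p : ℝ × (ℕ → ℝ) => consSeq p.1 p.2 :=
  measurable_pi_iff.2 fun n => by
    cases n with
    | zero => exact measurable_fst
    | succ n => exact (measurable_pi_apply n).comp measurable_snd

/-- The law of a sequence of independent exponential waiting times. -/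
noncomputable def waitLaw (r : ℝ) : Measure (ℕ → ℝ) := Measure.infinitePi fun _ => expMeasure r

instance : IsProbabilityMeasure (waitLaw r) := by unfold waitLaw; infer_instance

lemma map_consSeq_waitLaw :
    ((expMeasure r).prod (waitLaw r)).map (fun p => consSeq p.1 p.2) = waitLaw r := by
  refine Measure.eq_infinitePi _ fun s t ht => ?_
  obtain ⟨N, hN⟩ := s.exists_nat_subset_range
  have hN' : s ⊆ Finset.range (N + 1) :=
    hN.trans (Finset.range_mono (Nat.le_succ N))
  -- Free coordinates get the whole line, so that the cylinder lives on an initial segment and its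
  -- head can be split off.
  set t' : ℕ → Set ℝ := fun i => if i ∈ s then t i else Set.univ with ht'
  have hm : ∀ i, MeasurableSet (t' i) := fun i => by
    simp only [ht']; split_ifs; exacts [ht i, MeasurableSet.univ]
  have hpre : (fun p : ℝ × (ℕ → ℝ) => consSeq p.1 p.2) ⁻¹' (Set.pi s t) =
      t' 0 ×ˢ Set.pi (Finset.range N) fun i => t' (i + 1) := by
    ext ⟨a, v⟩
    simp only [Set.mem_preimage, Set.mem_pi, Finset.mem_coe, Set.mem_prod, Finset.mem_range, ht']
    constructor
    · intro h
      refine ⟨?_, fun i _ => ?_⟩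
      · split_ifs with h0
        exacts [h 0 h0, Set.mem_univ _]
      · split_ifs with h0
        exacts [h (i + 1) h0, Set.mem_univ _]
    · rintro ⟨h0, h1⟩ i hi
      cases i with
      | zero => rw [if_pos hi] at h0; exact h0
      | succ i =>
        have := h1 i (by have := Finset.mem_range.1 (hN' hi); omega)
        rw [if_pos hi] at this
        exact this
  rw [Measure.map_apply measurable_consSeq (MeasurableSet.pi s.countable_toSet fun i _ => ht i),
    hpre, Measure.prod_prod, waitLaw, Measure.infinitePi_pi _ fun i _ => hm (i + 1), mul_comm,
    ← Finset.prod_range_succ' (fun i => expMeasure r (t' i)), ← Finset.prod_subset hN']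
  · exact Finset.prod_congr rfl fun i hi => by simp only [ht', if_pos hi]
  · intro i _ hi
    simp only [ht', if_neg hi, measure_univ]

lemma lintegral_waitLaw {f : (ℕ → ℝ) → ℝ≥0∞} (hf : Measurable f) :
    ∫⁻ v, f v ∂waitLaw r = ∫⁻ t, ∫⁻ v, f (consSeq t v) ∂waitLaw r ∂expMeasure r := by
  have hfc : Measurable fun p : ℝ × (ℕ → ℝ) => f (consSeq p.1 p.2) := hf.comp measurable_consSeq
  conv_lhs => rw [← map_consSeq_waitLaw, lintegral_map hf measurable_consSeq,
    lintegral_prod _ hfc.aemeasurable]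

omit hr in
/-- The exponential distribution is memoryless. -/
lemma setLIntegral_expMeasure_shift {t : ℝ} (ht : 0 ≤ t) (g : ℝ → ℝ≥0∞) (hg : Measurable g) :
    ∫⁻ s in Set.Ioi t, g (s - t) ∂expMeasure r =
      ENNReal.ofReal (Real.exp (-(r * t))) * ∫⁻ s, g s ∂expMeasure r := by
  rw [lintegral_expMeasure, ← lintegral_const_mul _ (by fun_prop),
    ← lintegral_indicator measurableSet_Ioi, lintegral_expMeasure,
    ← lintegral_indicator measurableSet_Ioi, ← lintegral_indicator measurableSet_Ioi]
  conv_rhs => rw [← lintegral_sub_right_eq_self _ t]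
  refine lintegral_congr fun s => ?_
  by_cases h : t < s
  · have h1 : s ∈ Set.Ioi (0 : ℝ) := lt_of_le_of_lt ht h
    have h2 : s - t ∈ Set.Ioi (0 : ℝ) := sub_pos.2 h
    have h3 : s ∈ Set.Ioi t := h
    rw [Set.indicator_of_mem h1, Set.indicator_of_mem h2, Set.indicator_of_mem h3, ← mul_assoc,
      ← ENNReal.ofReal_mul (Real.exp_nonneg _)]
    congr 2
    rw [show -(r * s) = -(r * t) + -(r * (s - t)) by ring, Real.exp_add]
    ring
  · have h2 : s - t ∉ Set.Ioi (0 : ℝ) := fun h' => h (sub_pos.1 h')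
    have h3 : s ∉ Set.Ioi t := h
    rw [Set.indicator_of_notMem h2]
    by_cases h1 : s ∈ Set.Ioi (0 : ℝ)
    · rw [Set.indicator_of_mem h1, Set.indicator_of_notMem h3, mul_zero]
    · rw [Set.indicator_of_notMem h1]

/-- Only the head changes, so this is memorylessness of a single exponential variable with an
independent tail. The factor is the probability that the head exceeds `t`. -/
lemma map_restrict_waitLaw {t : ℝ} (ht : 0 ≤ t) :
    ((waitLaw r).restrict {v | t < v 0}).map (fun v => Function.update v 0 (v 0 - t)) =
      ENNReal.ofReal (Real.exp (-(r * t))) • waitLaw r := by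
  have hs : MeasurableSet {v : ℕ → ℝ | t < v 0} :=
    measurableSet_lt measurable_const (measurable_pi_apply 0)
  have hu : Measurable fun v : ℕ → ℝ => Function.update v 0 (v 0 - t) :=
    measurable_pi_iff.2 fun n => by
      cases n with
      | zero => simp only [Function.update_self]; fun_prop
      | succ n => simp only [Function.update_of_ne (Nat.succ_ne_zero n)]; fun_prop
  refine Measure.ext_of_lintegral _ fun f hf => ?_
  have hcons : ∀ s v, Function.update (consSeq s v) 0 (consSeq s v 0 - t) = consSeq (s - t) v := by
    intro s v
    funext n
    cases n with
    | zero => simp [consSeq]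
    | succ n => simp [consSeq]
  have hfc : Measurable fun p : ℝ × (ℕ → ℝ) => f (consSeq p.1 p.2) := hf.comp measurable_consSeq
  rw [lintegral_map hf hu, ← lintegral_indicator hs,
    lintegral_waitLaw (Measurable.indicator (f := fun v => f (Function.update v 0 (v 0 - t)))
      (hf.comp hu) hs), lintegral_smul_measure, smul_eq_mul,
    lintegral_waitLaw hf, ← setLIntegral_expMeasure_shift ht _ hfc.lintegral_prod_right',
    ← lintegral_indicator measurableSet_Ioi]
  refine lintegral_congr fun s => ?_
  by_cases h : t < s
  · have h3 : s ∈ Set.Ioi t := h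
    have h4 : ∀ v, consSeq s v ∈ {v : ℕ → ℝ | t < v 0} := fun v => h
    simp only [Set.indicator_of_mem h3, Set.indicator_of_mem (h4 _), hcons]
  · have h3 : s ∉ Set.Ioi t := h
    have h4 : ∀ v, consSeq s v ∉ {v : ℕ → ℝ | t < v 0} := fun v => h
    simp only [Set.indicator_of_notMem h3, Set.indicator_of_notMem (h4 _), lintegral_zero]

end WaitingTimes
-- The product law over the points
section StepLaw

variable {X : Type*} [Fintype X]

/-- The law of the waiting times in the distributed Poisson arrival model. -/
noncomputable def modelLaw (rate : X → ℝ) : Measure (X → ℕ → ℝ) :=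
  Measure.pi fun x => waitLaw (rate x)

lemma IsPoissonModel.map_eq {Ω : Type*} [MeasurableSpace Ω] {P : Measure Ω} {rate : X → ℝ}
    {W : X → ℕ → Ω → ℝ} (hW : IsPoissonModel P rate W) :
    P.map (fun ω x j => W x j ω) = modelLaw rate := by
  have : ∀ x, Fact (0 < rate x) := fun x => ⟨hW.rate_pos x⟩
  have h := hW.indep.map_fun_eq_infinitePi_map (fun p : X × ℕ => hW.measurable p.1 p.2)
  simp only [hW.law] at h
  have h2 := Measure.infinitePi_map_curry (fun (x : X) (_ : ℕ) => expMeasure (rate x))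
  have hm : Measurable fun ω (p : X × ℕ) => W p.1 p.2 ω :=
    measurable_pi_iff.2 fun p => hW.measurable p.1 p.2
  rw [← h, Measure.map_map (MeasurableEquiv.measurable _) hm, Measure.infinitePi_eq_pi] at h2
  exact h2

variable {rate : X → ℝ} [hrate : ∀ x, Fact (0 < rate x)]

instance : IsProbabilityMeasure (modelLaw rate) := by unfold modelLaw; infer_instance

open Classical in
-- Resampling one coordinate preserves a product law. This allows integrating over the waiting times
-- at `x` separately from those at the other points.
lemma map_update_modelLaw (x : X) :
    ((modelLaw rate).prod (waitLaw (rate x))).map (fun p => Function.update p.1 x p.2) =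
      modelLaw rate := by
  refine (Measure.pi_eq fun s hs => ?_).symm
  have hm : Measurable fun p : (X → ℕ → ℝ) × (ℕ → ℝ) => Function.update p.1 x p.2 := by
    fun_prop
  have hpre : (fun p : (X → ℕ → ℝ) × (ℕ → ℝ) => Function.update p.1 x p.2) ⁻¹'
      (Set.pi Set.univ s) = Set.pi Set.univ (Function.update s x Set.univ) ×ˢ s x := by
    ext ⟨w, u⟩
    simp only [Set.mem_preimage, Set.mem_univ_pi, Set.mem_prod]
    constructor
    · intro h
      refine ⟨fun y => ?_, by simpa using h x⟩
      by_cases hy : y = x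
      · subst hy; simp
      · simpa [hy] using h y
    · rintro ⟨h, hx⟩ y
      by_cases hy : y = x
      · subst hy; simpa using hx
      · simpa [hy] using h y
  rw [Measure.map_apply hm (MeasurableSet.univ_pi hs), hpre, Measure.prod_prod, modelLaw,
    Measure.pi_pi, ← Finset.mul_prod_erase _ _ (Finset.mem_univ x),
    ← Finset.mul_prod_erase _ (fun y => waitLaw (rate y) (s y)) (Finset.mem_univ x)]
  simp only [Function.update_self, measure_univ, one_mul]
  rw [mul_comm]
  congr 1
  exact Finset.prod_congr rfl fun y hy => by rw [Function.update_of_ne (Finset.ne_of_mem_erase hy)]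

open Classical in
lemma lintegral_modelLaw_update (x : X) {f : (X → ℕ → ℝ) → ℝ≥0∞} (hf : Measurable f) :
    ∫⁻ w, f w ∂modelLaw rate =
      ∫⁻ v, ∫⁻ w, f (Function.update w x v) ∂modelLaw rate ∂waitLaw (rate x) := by
  have hm : Measurable fun p : (X → ℕ → ℝ) × (ℕ → ℝ) => Function.update p.1 x p.2 := by
    fun_prop
  have hfc : Measurable fun p : (X → ℕ → ℝ) × (ℕ → ℝ) => f (Function.update p.1 x p.2) :=
    hf.comp hm
  conv_lhs => rw [← map_update_modelLaw x, lintegral_map hf hm,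
    lintegral_prod_symm _ hfc.aemeasurable]

open Classical in
/-- The waiting times at the points other than `x` after time `t`, if there is no request at them
before. -/
noncomputable def shiftOthers (x : X) (t : ℝ) (w : X → ℕ → ℝ) : X → ℕ → ℝ := fun y =>
  if y = x then w y else Function.update (w y) 0 (w y 0 - t)

lemma measurable_shiftHead (t : ℝ) :
    Measurable fun v : ℕ → ℝ => Function.update v 0 (v 0 - t) := by fun_prop

open Classical in
lemma setLIntegral_shiftOthers (x : X) {t : ℝ} (ht : 0 ≤ t) {f : (X → ℕ → ℝ) → ℝ≥0∞}
    (hf : Measurable f) :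
    ∫⁻ w in {w | ∀ y, y ≠ x → t < w y 0}, f (shiftOthers x t w) ∂modelLaw rate =
      ENNReal.ofReal (Real.exp (-((∑ y ∈ Finset.univ.erase x, rate y) * t))) *
        ∫⁻ w, f w ∂modelLaw rate := by
  have hset : {w : X → ℕ → ℝ | ∀ y, y ≠ x → t < w y 0} =
      Set.pi Set.univ fun y => if y = x then Set.univ else {v | t < v 0} := by
    ext w
    simp only [Set.mem_ofPred_eq, Set.mem_univ_pi]
    refine forall_congr' fun y => ?_
    split_ifs with h <;> simp [h]
  set F : X → (ℕ → ℝ) → ℕ → ℝ := fun y v =>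
    if y = x then v else Function.update v 0 (v 0 - t) with hF
  have hFm : ∀ y, Measurable (F y) := fun y => by
    simp only [hF]
    split_ifs
    exacts [measurable_id, measurable_shiftHead t]
  have hsh : shiftOthers x t = fun w y => F y (w y) := rfl
  have hm : Measurable (shiftOthers x t) :=
    measurable_pi_iff.2 fun y => (hFm y).comp (measurable_pi_apply y)
  have hmap : ∀ y, ((waitLaw (rate y)).restrict
      (if y = x then Set.univ else {v | t < v 0})).map (F y) =
      ENNReal.ofReal (Real.exp (-((if y = x then 0 else rate y) * t))) • waitLaw (rate y) := by
    intro y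
    simp only [hF]
    split_ifs with h
    · simp
    · exact map_restrict_waitLaw ht
  have : ∀ y, IsFiniteMeasure
      (ENNReal.ofReal (Real.exp (-((if y = x then 0 else rate y) * t))) • waitLaw (rate y)) :=
    fun y => Measure.smul_finite _ ENNReal.ofReal_ne_top
  rw [← lintegral_map hf hm, hset, modelLaw, Measure.restrict_pi_pi, hsh,
    Measure.pi_map_pi fun y => (hFm y).aemeasurable]
  simp only [hmap]
  rw [← smul_eq_mul, ← lintegral_smul_measure]
  congr 1
  refine Measure.pi_eq fun s hs => ?_
  simp only [Measure.smul_apply, Measure.pi_pi, smul_eq_mul, Finset.prod_mul_distrib]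
  rw [← ENNReal.ofReal_prod_of_nonneg fun _ _ => Real.exp_nonneg _, ← Real.exp_sum,
    ← Finset.add_sum_erase _ _ (Finset.mem_univ x)]
  congr 4
  simp only [if_true, zero_mul, neg_zero, zero_add, Finset.sum_mul, ← Finset.sum_neg_distrib]
  exact Finset.sum_congr rfl fun y hy => by rw [if_neg (Finset.ne_of_mem_erase hy)]

end StepLaw
-- Place and time of the first request
section FirstStep

variable {X : Type*} [Fintype X]

omit [Fintype X] in
lemma measurable_residual (x : X) :
    Measurable fun p : ℝ × (X → ℕ → ℝ) => residual x p.1 p.2 := by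
  refine measurable_pi_iff.2 fun y => measurable_pi_iff.2 fun n => ?_
  unfold residual
  split_ifs
  · fun_prop
  · cases n with
    | zero => simp only [Function.update_self]; fun_prop
    | succ n => simp only [Function.update_of_ne (Nat.succ_ne_zero n)]; fun_prop

section

variable [Nonempty X] [MeasurableSpace X] [DiscreteMeasurableSpace X]

omit [DiscreteMeasurableSpace X] in
-- `argmin` factors through the predicate of being a minimizer, and on the finite space of
-- predicates on `X` every function is measurable.
lemma measurable_argmin : Measurable (argmin : (X → ℝ) → X) := by
  classical
  set c : (X → Prop) → X := fun p => if h : ∃ x, p x then h.choose else Classical.arbitrary X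
    with hc
  have h1 : (argmin : (X → ℝ) → X) = c ∘ fun f x => ∀ y, f x ≤ f y := by
    funext f
    have : ∃ x, ∀ y, f x ≤ f y := Finite.exists_min f
    simp only [Function.comp_apply, hc]
    rw [dif_pos this]
    rfl
  rw [h1]
  refine (Measurable.of_discrete (f := c)).comp (measurable_pi_iff.2 fun x => ?_)
  refine measurable_to_prop ?_
  have : (fun f : X → ℝ => ∀ y, f x ≤ f y) ⁻¹' {True} = ⋂ y, {f | f x ≤ f y} := by
    ext f; simp
  rw [this]
  exact MeasurableSet.iInter fun y =>
    measurableSet_le (measurable_pi_apply x) (measurable_pi_apply y)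

omit [DiscreteMeasurableSpace X] in
lemma measurable_firstLoc : Measurable (firstLoc : (X → ℕ → ℝ) → X) := by
  have : (firstLoc : (X → ℕ → ℝ) → X) = argmin ∘ fun w y => w y 0 := funext firstLoc_eq
  rw [this]
  exact measurable_argmin.comp (by fun_prop)

omit [Nonempty X] in
lemma measurable_eval_discrete {S : Type*} [MeasurableSpace S] {β : Type*} [MeasurableSpace β]
    {f : X → S → β} (hf : ∀ x, Measurable (f x)) {g : S → X} (hg : Measurable g) :
    Measurable fun s => f (g s) s :=
  (measurable_from_prod_countable_right (f := fun p : X × S => f p.1 p.2) hf).comp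
    (hg.prodMk measurable_id)

lemma measurable_firstArr : Measurable (firstArr : (X → ℕ → ℝ) → ℝ) := by
  have : (firstArr : (X → ℕ → ℝ) → ℝ) = fun w => w (firstLoc w) 0 := funext firstArr_eq
  rw [this]
  exact measurable_eval_discrete (f := fun x (w : X → ℕ → ℝ) => w x 0) (by fun_prop)
    measurable_firstLoc

lemma measurable_step : Measurable (step : (X → ℕ → ℝ) → X → ℕ → ℝ) :=
  measurable_eval_discrete (f := fun x (w : X → ℕ → ℝ) => residual x (firstArr w) w)
    (fun x => (measurable_residual x).comp (measurable_firstArr.prodMk measurable_id))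
    measurable_firstLoc

lemma measurable_nthLoc (n : ℕ) : Measurable fun w : X → ℕ → ℝ => nthLoc w n := by
  simp only [nthLoc_eq]
  exact measurable_firstLoc.comp (measurable_step.iterate n)

lemma measurable_nthArr (n : ℕ) : Measurable fun w : X → ℕ → ℝ => nthArr w n := by
  induction n with
  | zero => exact measurable_firstArr
  | succ n ih =>
    simp only [nthArr_succ]
    exact measurable_firstArr.add (ih.comp measurable_step)

end

/-- The event that the first request is at `x` and is not simultaneous with another one. -/
def firstAt (x : X) : Set (X → ℕ → ℝ) := {w | ∀ y, y ≠ x → w x 0 < w y 0}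

lemma measurableSet_firstAt (x : X) : MeasurableSet (firstAt x) := by
  have : firstAt x = ⋂ y : X, {w : X → ℕ → ℝ | y ≠ x → w x 0 < w y 0} := by
    ext w; simp [firstAt]
  rw [this]
  refine MeasurableSet.iInter fun y => ?_
  by_cases h : y = x
  · simp [h]
  · simp only [ne_eq, h, not_false_eq_true, true_imp_iff]
    exact measurableSet_lt (by fun_prop) (by fun_prop)

lemma firstLoc_eq_of_mem_firstAt [Nonempty X] {x : X} {w : X → ℕ → ℝ} (h : w ∈ firstAt x) :
    firstLoc w = x := by
  by_contra hne
  have h1 := h _ hne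
  have h2 := argmin_le (fun y => w y 0) x
  rw [← firstLoc_eq] at h2
  exact absurd h1 (not_lt.2 h2)

omit [Fintype X] in
lemma residual_update_consSeq [DecidableEq X] (x : X) (t s : ℝ) (v : ℕ → ℝ) (w : X → ℕ → ℝ) :
    residual x t (Function.update w x (consSeq s v)) =
      Function.update (shiftOthers x t w) x v := by
  funext y
  by_cases h : y = x
  · subst h
    simp only [residual, if_true, Function.update_self]
    rfl
  · simp [residual, shiftOthers, h]

variable {rate : X → ℝ} [hrate : ∀ x, Fact (0 < rate x)]

/-- Fix the head `t` at `x`, with density λ_x exp(-λ_x t). The other points have no request up to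
`t` with probability exp(-(Λ - λ_x) t) and then restart by memorylessness, while the tail at `x` is
fresh anyway. The exponentials multiply to exp(-Λ t). -/
lemma setLIntegral_firstAt (x : X) {G : ℝ → (X → ℕ → ℝ) → ℝ≥0∞}
    (hG : Measurable (Function.uncurry G)) :
    ∫⁻ w in firstAt x, G (w x 0) (residual x (w x 0) w) ∂modelLaw rate =
      ∫⁻ t in Set.Ioi 0, ENNReal.ofReal (rate x * Real.exp (-((∑ y, rate y) * t))) *
        ∫⁻ w, G t w ∂modelLaw rate := by
  classical
  have hGr : Measurable fun w : X → ℕ → ℝ => G (w x 0) (residual x (w x 0) w) :=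
    hG.comp (Measurable.prodMk (by fun_prop)
      ((measurable_residual x).comp (Measurable.prodMk (by fun_prop) measurable_id)))
  have hind := hGr.indicator (measurableSet_firstAt x)
  have hm : Measurable fun p : (X → ℕ → ℝ) × (ℕ → ℝ) => Function.update p.1 x p.2 := by
    fun_prop
  rw [← lintegral_indicator (measurableSet_firstAt x), lintegral_modelLaw_update x hind,
    lintegral_waitLaw (Measurable.lintegral_prod_left' (f := fun p : (X → ℕ → ℝ) × (ℕ → ℝ) =>
      (firstAt x).indicator (fun w : X → ℕ → ℝ => G (w x 0) (residual x (w x 0) w))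
        (Function.update p.1 x p.2)) (hind.comp hm)), lintegral_expMeasure]
  refine setLIntegral_congr_fun measurableSet_Ioi fun t ht => ?_
  have hGt : Measurable (G t) := hG.comp (measurable_const.prodMk measurable_id)
  have hv : ∀ v : ℕ → ℝ, ∫⁻ w, (firstAt x).indicator
      (fun w : X → ℕ → ℝ => G (w x 0) (residual x (w x 0) w))
        (Function.update w x (consSeq t v)) ∂modelLaw rate =
      ENNReal.ofReal (Real.exp (-((∑ y ∈ Finset.univ.erase x, rate y) * t))) *
        ∫⁻ w, G t (Function.update w x v) ∂modelLaw rate := by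
    intro v
    rw [← setLIntegral_shiftOthers x (le_of_lt ht) (f := fun w => G t (Function.update w x v))
      (hGt.comp (by fun_prop)), ← lintegral_indicator]
    · refine lintegral_congr fun w => ?_
      have hiff : Function.update w x (consSeq t v) ∈ firstAt x ↔
          w ∈ {w : X → ℕ → ℝ | ∀ y, y ≠ x → t < w y 0} := by
        simp only [firstAt, Set.mem_ofPred_eq]
        refine forall_congr' fun y => forall_congr' fun hy => ?_
        rw [Function.update_self, Function.update_of_ne hy]
        rfl
      by_cases h : Function.update w x (consSeq t v) ∈ firstAt x
      · rw [Set.indicator_of_mem h, Set.indicator_of_mem (hiff.1 h), residual_update_consSeq,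
          Function.update_self]
        rfl
      · rw [Set.indicator_of_notMem h, Set.indicator_of_notMem (fun h' => h (hiff.2 h'))]
    · have : {w : X → ℕ → ℝ | ∀ y, y ≠ x → t < w y 0} =
          ⋂ y : X, {w : X → ℕ → ℝ | y ≠ x → t < w y 0} := by ext w; simp
      rw [this]
      refine MeasurableSet.iInter fun y => ?_
      by_cases h : y = x
      · simp [h]
      · simp only [ne_eq, h, not_false_eq_true, true_imp_iff]
        exact measurableSet_lt (by fun_prop) (by fun_prop)
  have hGu : Measurable fun p : (X → ℕ → ℝ) × (ℕ → ℝ) => G t (Function.update p.1 x p.2) :=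
    hGt.comp hm
  simp only [hv]
  rw [lintegral_const_mul _ hGu.lintegral_prod_left', ← lintegral_modelLaw_update x hGt,
    ← mul_assoc, ← ENNReal.ofReal_mul (mul_nonneg (hrate x).out.le (Real.exp_nonneg _)), mul_assoc,
    ← Real.exp_add, ← Finset.add_sum_erase _ _ (Finset.mem_univ x)]
  congr 4
  ring

end FirstStep
-- The restart preserves the law; expected sums over the requests
section StepIdentity

variable {X : Type*} [Fintype X] [Nonempty X] [MeasurableSpace X] [DiscreteMeasurableSpace X]
variable {rate : X → ℝ} [hrate : ∀ x, Fact (0 < rate x)]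

instance : Fact (0 < ∑ x, rate x) :=
  ⟨Finset.sum_pos (fun x _ => (hrate x).out) Finset.univ_nonempty⟩

omit [Nonempty X] [MeasurableSpace X] [DiscreteMeasurableSpace X] in
lemma sum_ofReal_rate_mul (c : ℝ) (hc : 0 ≤ c) :
    ∑ x, ENNReal.ofReal (rate x * c) = ENNReal.ofReal ((∑ x, rate x) * c) := by
  rw [Finset.sum_mul, ENNReal.ofReal_sum_of_nonneg]
  exact fun x _ => mul_nonneg (hrate x).out.le hc

omit [Nonempty X] [MeasurableSpace X] [DiscreteMeasurableSpace X] in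
lemma lintegral_sum_rate (f : ℝ → ℝ≥0∞) :
    ∫⁻ t in Set.Ioi 0, (∑ x, ENNReal.ofReal (rate x * Real.exp (-((∑ y, rate y) * t)))) * f t =
      ∫⁻ t, f t ∂expMeasure (∑ y, rate y) := by
  rw [lintegral_expMeasure]
  exact lintegral_congr fun t => by rw [sum_ofReal_rate_mul _ (Real.exp_nonneg _)]

omit [Fintype X] [Nonempty X] [MeasurableSpace X] [DiscreteMeasurableSpace X] in
lemma pairwise_disjoint_firstAt : Pairwise (Function.onFun Disjoint (firstAt : X → Set _)) := by
  intro x y hxy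
  refine Set.disjoint_left.2 fun w hx hy => ?_
  exact lt_asymm (hx y hxy.symm) (hy x hxy)

omit [MeasurableSpace X] [DiscreteMeasurableSpace X] in
-- Ties are excluded by total mass: the disjoint events `firstAt x` have probabilities whose sum is
-- the integral of the exponential density with rate Λ, which is 1.
lemma ae_mem_iUnion_firstAt : ∀ᵐ w ∂modelLaw rate, w ∈ ⋃ x, firstAt x := by
  change modelLaw rate (⋃ x, firstAt x)ᶜ = 0
  rw [prob_compl_eq_zero_iff (MeasurableSet.iUnion measurableSet_firstAt),
    measure_iUnion pairwise_disjoint_firstAt measurableSet_firstAt, tsum_fintype]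
  have h : ∀ x, modelLaw rate (firstAt x) = ∫⁻ t in Set.Ioi 0,
      ENNReal.ofReal (rate x * Real.exp (-((∑ y, rate y) * t))) := by
    intro x
    have := setLIntegral_firstAt (rate := rate) x (G := fun _ _ => 1) measurable_const
    simpa using this
  simp only [h]
  rw [← lintegral_finsetSum _ fun x _ => by fun_prop]
  have := lintegral_sum_rate (rate := rate) fun _ => 1
  simpa using this

omit [MeasurableSpace X] [DiscreteMeasurableSpace X] in
/-- First-step decomposition: the first request arrives after an exponential time, at a point
chosen independently with probability proportional to its rate, and the waiting times after it
are independent of both and have the same law as at the beginning. -/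
lemma lintegral_step {G : X → ℝ → (X → ℕ → ℝ) → ℝ≥0∞}
    (hG : ∀ x, Measurable (Function.uncurry (G x))) :
    ∫⁻ w, G (firstLoc w) (firstArr w) (step w) ∂modelLaw rate =
      ∫⁻ t in Set.Ioi 0, ∑ x, ENNReal.ofReal (rate x * Real.exp (-((∑ y, rate y) * t))) *
        ∫⁻ w, G x t w ∂modelLaw rate := by
  have h1 : ∀ x, ∫⁻ w in firstAt x, G (firstLoc w) (firstArr w) (step w) ∂modelLaw rate =
      ∫⁻ w in firstAt x, G x (w x 0) (residual x (w x 0) w) ∂modelLaw rate := by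
    refine fun x => setLIntegral_congr_fun (measurableSet_firstAt x) fun w hw => ?_
    have := firstLoc_eq_of_mem_firstAt hw
    simp only [step, firstArr_eq, this]
  have h2 : (⋃ x, firstAt x : Set (X → ℕ → ℝ)) =ᵐ[modelLaw rate] Set.univ :=
    eventuallyEq_univ.2 ae_mem_iUnion_firstAt
  rw [← setLIntegral_univ, ← setLIntegral_congr h2,
    lintegral_iUnion measurableSet_firstAt pairwise_disjoint_firstAt, tsum_fintype]
  simp only [h1, setLIntegral_firstAt _ (hG _)]
  rw [lintegral_finsetSum]
  intro x _
  exact Measurable.mul (by fun_prop) (hG x).lintegral_prod_right'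

omit [MeasurableSpace X] [DiscreteMeasurableSpace X] in
lemma lintegral_comp_step {f : (X → ℕ → ℝ) → ℝ≥0∞} (hf : Measurable f) :
    ∫⁻ w, f (step w) ∂modelLaw rate = ∫⁻ w, f w ∂modelLaw rate := by
  rw [lintegral_step (G := fun _ _ w => f w) fun _ => hf.comp measurable_snd]
  simp only [← Finset.sum_mul]
  rw [lintegral_sum_rate]
  simp

lemma measurePreserving_step :
    MeasurePreserving step (modelLaw rate) (modelLaw rate) :=
  ⟨measurable_step, Measure.ext_of_lintegral _ fun f hf => by
    rw [lintegral_map hf measurable_step, lintegral_comp_step hf]⟩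

omit [MeasurableSpace X] [DiscreteMeasurableSpace X] in
lemma lintegral_firstLoc_step {f : X → (X → ℕ → ℝ) → ℝ≥0∞} (hf : ∀ x, Measurable (f x)) :
    ∫⁻ w, f (firstLoc w) (step w) ∂modelLaw rate =
      ∑ x, ENNReal.ofReal (rate x / ∑ y, rate y) * ∫⁻ w, f x w ∂modelLaw rate := by
  rw [lintegral_step (G := fun x _ w => f x w) fun x => (hf x).comp measurable_snd,
    lintegral_finsetSum _ fun x _ => by fun_prop]
  refine Finset.sum_congr rfl fun x _ => ?_
  rw [lintegral_mul_const _ (by fun_prop)]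
  congr 1
  have hpos : 0 < ∑ y, rate y := Fact.out
  have h := lintegral_expMeasure (r := ∑ y, rate y) fun _ => 1
  have h2 : ∀ t, ENNReal.ofReal (rate x * Real.exp (-((∑ y, rate y) * t))) =
      ENNReal.ofReal (rate x / ∑ y, rate y) *
        (ENNReal.ofReal ((∑ y, rate y) * Real.exp (-((∑ y, rate y) * t))) * 1) := by
    intro t
    rw [mul_one, ← ENNReal.ofReal_mul (div_nonneg (hrate x).out.le hpos.le)]
    congr 1
    field_simp
  simp only [h2]
  rw [lintegral_const_mul _ (by fun_prop), ← h]
  simp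

/-- The waiting times after request number `k` are independent of its location and have the same
law as at the beginning. -/
lemma lintegral_nthLoc_step (k : ℕ) {f : X → (X → ℕ → ℝ) → ℝ≥0∞} (hf : ∀ x, Measurable (f x)) :
    ∫⁻ w, f (nthLoc w k) (step^[k + 1] w) ∂modelLaw rate =
      ∑ x, ENNReal.ofReal (rate x / ∑ y, rate y) * ∫⁻ w, f x w ∂modelLaw rate := by
  simp only [nthLoc_eq, Function.iterate_succ_apply']
  rw [← lintegral_firstLoc_step hf]
  exact (measurePreserving_step.iterate k).lintegral_comp (f := fun w => f (firstLoc w) (step w))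
    (measurable_eval_discrete (fun x => (hf x).comp measurable_step) measurable_firstLoc)

lemma ae_firstArr_pos : ∀ᵐ w ∂modelLaw rate, 0 < firstArr w := by
  have hs : MeasurableSet {w : X → ℕ → ℝ | ¬ 0 < firstArr w} :=
    (measurableSet_lt measurable_const measurable_firstArr).compl
  rw [ae_iff, ← lintegral_indicator_one hs]
  have h := lintegral_step (rate := rate)
    (G := fun _ t _ => (Set.Iic (0 : ℝ)).indicator 1 t) fun _ =>
      (measurable_one.indicator measurableSet_Iic).comp measurable_fst
  have h2 : ∀ w : X → ℕ → ℝ, {w : X → ℕ → ℝ | ¬ 0 < firstArr w}.indicator (1 : (X → ℕ → ℝ) → ℝ≥0∞) w =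
      (Set.Iic (0 : ℝ)).indicator 1 (firstArr w) := by
    intro w
    simp [Set.indicator_apply]
  simp only [h2]
  rw [h]
  refine (setLIntegral_congr_fun measurableSet_Ioi fun t ht => ?_).trans lintegral_zero
  have : t ∉ Set.Iic (0 : ℝ) := fun h' => not_lt_of_ge (Set.mem_Iic.1 h') (Set.mem_Ioi.1 ht)
  simp [this]

lemma ae_strictMono_nthArr : ∀ᵐ w ∂modelLaw rate, StrictMono (nthArr w) := by
  have h : ∀ᵐ w ∂modelLaw rate, ∀ k, 0 < firstArr (step^[k] w) :=
    ae_all_iff.2 fun k => (measurePreserving_step.iterate k).quasiMeasurePreserving.ae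
      ae_firstArr_pos
  filter_upwards [h] with w hw
  refine strictMono_nat_of_lt_succ fun k => ?_
  have := nthArr_add w k 0
  rw [add_zero] at this
  rw [this]
  have h2 : 0 < nthArr (step^[k + 1] w) 0 := hw (k + 1)
  linarith

omit [Nonempty X] [MeasurableSpace X] [DiscreteMeasurableSpace X] in
lemma measure_expMeasure_Ioi {r : ℝ} [Fact (0 < r)] {s : ℝ} (hs : 0 ≤ s) :
    expMeasure r (Set.Ioi s) = ENNReal.ofReal (Real.exp (-(r * s))) := by
  have := setLIntegral_expMeasure_shift (r := r) hs (fun _ => 1) measurable_const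
  simpa using this

/-- For an exponential time T, the first summand weights `h s` by P(T > s). The second, after
Tonelli and a translation, weights it by P(T < s). -/
lemma lintegral_expMeasure_shift_le {r : ℝ} [Fact (0 < r)] {h : ℝ → ℝ≥0∞} (hh : Measurable h) :
    (∫⁻ s in Set.Ioi 0, ENNReal.ofReal (Real.exp (-(r * s))) * h s) +
      ∫⁻ t, (∫⁻ s in Set.Ioi 0, h (t + s)) ∂expMeasure r ≤ ∫⁻ s in Set.Ioi 0, h s := by
  have h1 : ∫⁻ t, (∫⁻ s in Set.Ioi 0, h (t + s)) ∂expMeasure r =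
      ∫⁻ s in Set.Ioi 0, expMeasure r (Set.Iio s) * h s := by
    have e1 : ∀ t ∈ Set.Ioi (0 : ℝ), ENNReal.ofReal (r * Real.exp (-(r * t))) *
        ∫⁻ s in Set.Ioi 0, h (t + s) = ∫⁻ s in Set.Ioi 0,
          ENNReal.ofReal (r * Real.exp (-(r * t))) * ((Set.Iio s).indicator 1 t * h s) := by
      intro t ht
      rw [lintegral_const_mul']
      swap
      · exact ENNReal.ofReal_ne_top
      congr 1
      rw [← lintegral_indicator measurableSet_Ioi, ← lintegral_indicator measurableSet_Ioi,
        ← lintegral_add_left_eq_self (fun s => (Set.Ioi 0).indicator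
          (fun s => (Set.Iio s).indicator 1 t * h s) s) t]
      refine lintegral_congr fun s => ?_
      have ht' : (0 : ℝ) < t := ht
      by_cases hs : 0 < s
      · have a1 : s ∈ Set.Ioi (0 : ℝ) := hs
        have a2 : t + s ∈ Set.Ioi (0 : ℝ) := add_pos ht' hs
        have a3 : t ∈ Set.Iio (t + s) := lt_add_of_pos_right t hs
        simp [a1, a2, a3]
      · have a1 : s ∉ Set.Ioi (0 : ℝ) := hs
        have a3 : t ∉ Set.Iio (t + s) := fun h' => hs (by simpa using h')
        simp only [Set.indicator_of_notMem a1]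
        by_cases a2 : t + s ∈ Set.Ioi (0 : ℝ)
        · simp [a2, a3]
        · rw [Set.indicator_of_notMem a2]
    rw [lintegral_expMeasure, setLIntegral_congr_fun measurableSet_Ioi e1,
      lintegral_lintegral_swap]
    · refine lintegral_congr fun s => ?_
      rw [← lintegral_indicator_one measurableSet_Iio, lintegral_expMeasure,
        ← lintegral_mul_const]
      · exact lintegral_congr fun t => by rw [mul_assoc]
      · exact Measurable.mul (by fun_prop) (measurable_one.indicator measurableSet_Iio)
    · refine Measurable.aemeasurable ?_
      have : Measurable fun p : ℝ × ℝ => (Set.Iio p.2).indicator (1 : ℝ → ℝ≥0∞) p.1 := by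
        have e : (fun p : ℝ × ℝ => (Set.Iio p.2).indicator (1 : ℝ → ℝ≥0∞) p.1) =
            {p : ℝ × ℝ | p.1 < p.2}.indicator 1 := by
          funext p; simp [Set.indicator_apply]
        rw [e]
        exact measurable_one.indicator (measurableSet_lt measurable_fst measurable_snd)
      exact Measurable.mul (by fun_prop) (this.mul (hh.comp measurable_snd))
  rw [h1, ← lintegral_add_left (by fun_prop)]
  refine setLIntegral_mono' measurableSet_Ioi fun s hs => ?_
  have hd : Disjoint (Set.Ioi s) (Set.Iio s) :=
    Set.disjoint_left.2 fun t h1 h2 => lt_asymm (Set.mem_Ioi.1 h1) (Set.mem_Iio.1 h2)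
  rw [← add_mul, ← measure_expMeasure_Ioi (le_of_lt hs), ← measure_union hd measurableSet_Iio]
  exact mul_le_of_le_one_left' prob_le_one

/-- The expected sum of `h` over the first `n` requests is at most its integral with respect to
the intensity of the arrival process. -/
lemma lintegral_sum_le (n : ℕ) {h : X → ℝ → ℝ≥0∞} (hh : ∀ x, Measurable (h x)) :
    ∫⁻ w, ∑ j ∈ Finset.range n, h (nthLoc w j) (nthArr w j) ∂modelLaw rate ≤
      ∑ y, ENNReal.ofReal (rate y) * ∫⁻ s in Set.Ioi 0, h y s := by
  induction n generalizing h with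
  | zero => simp
  | succ n ih =>
    set Λ := ∑ y, rate y with hΛ
    set G : X → ℝ → (X → ℕ → ℝ) → ℝ≥0∞ := fun x t w =>
      h x t + ∑ j ∈ Finset.range n, h (nthLoc w j) (t + nthArr w j) with hGdef
    have hm : ∀ j, Measurable fun p : ℝ × (X → ℕ → ℝ) =>
        h (nthLoc p.2 j) (p.1 + nthArr p.2 j) := fun j =>
      measurable_eval_discrete
        (f := fun x (p : ℝ × (X → ℕ → ℝ)) => h x (p.1 + nthArr p.2 j))
        (fun x => (hh x).comp (measurable_fst.add ((measurable_nthArr j).comp measurable_snd)))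
        ((measurable_nthLoc j).comp measurable_snd)
    have hG : ∀ x, Measurable (Function.uncurry (G x)) := fun x =>
      ((hh x).comp measurable_fst).add (Finset.measurable_fun_sum _ fun j _ => hm j)
    have e1 : ∀ w : X → ℕ → ℝ, ∑ j ∈ Finset.range (n + 1), h (nthLoc w j) (nthArr w j) =
        G (firstLoc w) (firstArr w) (step w) := by
      intro w
      rw [Finset.sum_range_succ', add_comm]
      simp only [hGdef, nthLoc_succ, nthArr_succ]
      rfl
    set H : ℝ → ℝ≥0∞ := fun t => ∑ y, ENNReal.ofReal (rate y) * ∫⁻ s in Set.Ioi 0, h y (t + s)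
      with hH
    have hHm : ∀ y, Measurable fun t => ∫⁻ s in Set.Ioi 0, h y (t + s) := fun y =>
      Measurable.lintegral_prod_right' (f := fun p : ℝ × ℝ => h y (p.1 + p.2))
        ((hh y).comp (measurable_fst.add measurable_snd))
    have e2 : ∀ x t, ∫⁻ w, G x t w ∂modelLaw rate ≤ h x t + H t := by
      intro x t
      simp only [hGdef]
      rw [lintegral_add_left measurable_const, lintegral_const, measure_univ, mul_one]
      gcongr
      -- The requests after the first are those of the restarted process, seen by `h` with its time
      -- shifted by `t`.
      exact ih (h := fun y s => h y (t + s)) fun y => (hh y).comp (measurable_const.add measurable_id)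
    simp only [e1]
    rw [lintegral_step hG]
    calc ∫⁻ t in Set.Ioi 0, ∑ x, ENNReal.ofReal (rate x * Real.exp (-(Λ * t))) *
          ∫⁻ w, G x t w ∂modelLaw rate
        ≤ ∫⁻ t in Set.Ioi 0, (∑ x, ENNReal.ofReal (rate x) *
            (ENNReal.ofReal (Real.exp (-(Λ * t))) * h x t) +
          (∑ x, ENNReal.ofReal (rate x * Real.exp (-(Λ * t)))) * H t) := by
          refine lintegral_mono fun t => ?_
          rw [Finset.sum_mul (f := fun x => ENNReal.ofReal (rate x * Real.exp (-(Λ * t)))), ← Finset.sum_add_distrib]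
          refine Finset.sum_le_sum fun x _ => ?_
          refine (mul_le_mul_right (e2 x t) _).trans (le_of_eq ?_)
          rw [mul_add, ENNReal.ofReal_mul (hrate x).out.le, mul_assoc]
      _ = ∑ x, ENNReal.ofReal (rate x) *
            (∫⁻ t in Set.Ioi 0, ENNReal.ofReal (Real.exp (-(Λ * t))) * h x t) +
          ∑ y, ENNReal.ofReal (rate y) *
            ∫⁻ t, (∫⁻ s in Set.Ioi 0, h y (t + s)) ∂expMeasure Λ := by
          have m1 : ∀ x, Measurable fun t =>
              ENNReal.ofReal (Real.exp (-(Λ * t))) * h x t := fun x =>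
            Measurable.mul (by fun_prop) (hh x)
          rw [lintegral_add_left (Finset.measurable_fun_sum _ fun x _ => (m1 x).const_mul _),
            lintegral_sum_rate,
            lintegral_finsetSum _ fun x _ => (m1 x).const_mul _,
            lintegral_finsetSum _ fun y _ => (hHm y).const_mul _]
          congr 1
          · exact Finset.sum_congr rfl fun x _ => lintegral_const_mul _ (m1 x)
          · exact Finset.sum_congr rfl fun x _ => lintegral_const_mul _ (hHm x)
      _ ≤ _ := by
          rw [← Finset.sum_add_distrib]
          refine Finset.sum_le_sum fun y _ => ?_
          rw [← mul_add]
          exact mul_le_mul_right (lintegral_expMeasure_shift_le (hh y)) _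

end StepIdentity
-- The probability that a space-time region receives no request
section Survival

variable {X : Type*} [Fintype X]

/-- The total intensity of the arrivals at the points `x` in the time intervals from `c x` to
`a`, after time `t`. -/
noncomputable def intensity (rate : X → ℝ) (c : X → ℝ) (a t : ℝ) : ℝ :=
  ∑ y, rate y * max (a - max (c y) t) 0

lemma continuous_intensity (rate : X → ℝ) (c : X → ℝ) (a : ℝ) :
    Continuous (intensity rate c a) := by
  unfold intensity
  fun_prop

lemma hasDerivAt_intensity (rate : X → ℝ) (c : X → ℝ) {a t : ℝ} (hta : t < a)
    (hc : ∀ y, c y ≠ t) :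
    HasDerivAt (intensity rate c a) (-∑ y, if t ≤ c y then 0 else rate y) t := by
  unfold intensity
  rw [← Finset.sum_neg_distrib]
  refine HasDerivAt.fun_sum fun y _ => ?_
  rcases lt_or_gt_of_ne (hc y) with h | h
  · rw [if_neg (not_le.2 h)]
    have h1 : HasDerivAt (fun s => rate y * (a - s)) (-rate y) t := by
      simpa using ((hasDerivAt_id t).const_sub a).const_mul (rate y)
    refine h1.congr_of_eventuallyEq ?_
    filter_upwards [lt_mem_nhds h, gt_mem_nhds hta] with s hs1 hs2
    rw [max_eq_right hs1.le, max_eq_left (sub_nonneg.2 hs2.le)]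
  · rw [if_pos h.le, neg_zero]
    refine (hasDerivAt_const t (rate y * max (a - c y) 0)).congr_of_eventuallyEq ?_
    filter_upwards [gt_mem_nhds h] with s hs
    rw [max_eq_left hs.le]

variable {rate : X → ℝ} [hrate : ∀ x, Fact (0 < rate x)]

/-- This is the first-step recursion solved by exp(-intensity). Off the finitely many kinks `c y`,
the integrand is the derivative of -exp(-Λ t - `intensity rate c a t`), because the rates with `c y
< t` cancel from Λ. -/
lemma lintegral_intensity (c : X → ℝ) {a : ℝ} (ha : 0 ≤ a) :
    (∫⁻ t in Set.Ioc 0 a, ENNReal.ofReal ((∑ x, if t ≤ c x then rate x else 0) *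
      Real.exp (-((∑ y, rate y) * t) - intensity rate c a t))) +
        ENNReal.ofReal (Real.exp (-((∑ y, rate y) * a))) =
      ENNReal.ofReal (Real.exp (-intensity rate c a 0)) := by
  set Λ := ∑ y, rate y with hΛ
  set g : ℝ → ℝ := fun t => Real.exp (-(Λ * t) - intensity rate c a t) with hg
  set R : ℝ → ℝ := fun t => ∑ x, if t ≤ c x then rate x else 0 with hR
  have hgc : Continuous g := by
    have := continuous_intensity rate c a
    fun_prop
  have hR0 : ∀ t, 0 ≤ R t := fun t => Finset.sum_nonneg fun x _ => by
    split_ifs; exacts [(hrate x).out.le, le_rfl]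
  have hRle : ∀ t, R t ≤ Λ := fun t => Finset.sum_le_sum fun x _ => by
    split_ifs; exacts [le_rfl, (hrate x).out.le]
  have hRm : Measurable R := Finset.measurable_fun_sum _ fun x _ =>
    Measurable.ite measurableSet_Iic measurable_const measurable_const
  have hint : IntervalIntegrable (fun t => R t * g t) volume 0 a := by
    refine ((hgc.const_mul Λ).intervalIntegrable 0 a).mono_fun
      (hRm.mul hgc.measurable).aestronglyMeasurable (ae_of_all _ fun t => ?_)
    beta_reduce
    rw [Real.norm_of_nonneg (mul_nonneg (hR0 t) (Real.exp_nonneg _)),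
      Real.norm_of_nonneg (mul_nonneg ((hR0 t).trans (hRle t)) (Real.exp_nonneg _))]
    exact mul_le_mul_of_nonneg_right (hRle t) (Real.exp_nonneg _)
  have hftc : ∫ t in (0)..a, R t * g t = -g a - -g 0 := by
    refine integral_eq_of_hasDerivAt_off_countable_of_le (fun t => -g t) _ ha
      (Set.finite_range c).countable hgc.neg.continuousOn (fun t ht => ?_) hint
    have hct : ∀ y, c y ≠ t := fun y hy => ht.2 ⟨y, hy⟩
    have h1 := (((((hasDerivAt_id t).const_mul Λ).neg).sub
      (hasDerivAt_intensity rate c ht.1.2 hct)).exp).neg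
    refine h1.congr_deriv ?_
    have h2 : R t = Λ - ∑ y, if t ≤ c y then 0 else rate y := by
      rw [hΛ, ← Finset.sum_sub_distrib]
      exact Finset.sum_congr rfl fun x _ => by split_ifs <;> simp
    rw [h2]
    simp only [hg, id, Pi.neg_apply, Pi.sub_apply]
    ring
  have hga : g a = Real.exp (-(Λ * a)) := by
    have : intensity rate c a a = 0 := Finset.sum_eq_zero fun y _ => by
      rw [max_eq_right (sub_nonpos.2 (le_max_right _ _)), mul_zero]
    simp only [hg, this, sub_zero]
  have hg0 : g 0 = Real.exp (-intensity rate c a 0) := by simp [hg]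
  rw [← ofReal_integral_eq_lintegral_ofReal (hint.1.mono_set le_rfl)
    (ae_of_all _ fun t => mul_nonneg (hR0 t) (Real.exp_nonneg _)),
    ← intervalIntegral.integral_of_le ha, hftc, ← hga, ← hg0, ← ENNReal.ofReal_add]
  · congr 1; ring
  · rw [← hftc]
    exact intervalIntegral.integral_nonneg ha fun t _ => mul_nonneg (hR0 t) (Real.exp_nonneg _)
  · exact Real.exp_nonneg _

variable [Nonempty X] [MeasurableSpace X] [DiscreteMeasurableSpace X]

/-- The event that request number `N` arrives after time `a`, while no earlier request arrives at
a point `x` in the time interval from `c x` to `a`. -/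
def quiet (N : ℕ) (c : X → ℝ) (a : ℝ) : Set (X → ℕ → ℝ) :=
  {w | a < nthArr w N ∧ ∀ j < N, c (nthLoc w j) < nthArr w j → a < nthArr w j}

omit [MeasurableSpace X] [DiscreteMeasurableSpace X] in
lemma mem_quiet_succ {N : ℕ} {c : X → ℝ} {a : ℝ} {w : X → ℕ → ℝ} :
    w ∈ quiet (N + 1) c a ↔ (c (firstLoc w) < firstArr w → a < firstArr w) ∧
      step w ∈ quiet N (fun x => c x - firstArr w) (a - firstArr w) := by
  simp only [quiet, Set.mem_ofPred_eq, nthArr_succ]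
  constructor
  · rintro ⟨h1, h2⟩
    refine ⟨h2 0 (Nat.succ_pos N), by linarith, fun j hj hcj => ?_⟩
    have := h2 (j + 1) (Nat.succ_lt_succ hj)
    rw [nthArr_succ, nthLoc_succ] at this
    linarith [this (by linarith)]
  · rintro ⟨h1, h2, h3⟩
    refine ⟨by linarith, fun j hj => ?_⟩
    cases j with
    | zero => exact h1
    | succ j =>
      rw [nthArr_succ, nthLoc_succ]
      intro hcj
      linarith [h3 j (Nat.lt_of_succ_lt_succ hj) (by linarith)]

lemma measurableSet_mem_quiet {S : Type*} [MeasurableSpace S] (N : ℕ) {c : X → S → ℝ}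
    (hc : ∀ x, Measurable (c x)) {a : S → ℝ} (ha : Measurable a) {w : S → X → ℕ → ℝ}
    (hw : Measurable w) : MeasurableSet {s | w s ∈ quiet N (fun x => c x s) (a s)} := by
  have hm : ∀ j, Measurable fun s => nthArr (w s) j := fun j => (measurable_nthArr j).comp hw
  have hcm : ∀ j, Measurable fun s => c (nthLoc (w s) j) s := fun j =>
    measurable_eval_discrete hc ((measurable_nthLoc j).comp hw)
  have : {s | w s ∈ quiet N (fun x => c x s) (a s)} = {s | a s < nthArr (w s) N} ∩
      ⋂ j : Fin N, ({s | nthArr (w s) j ≤ c (nthLoc (w s) j) s} ∪ {s | a s < nthArr (w s) j}) := by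
    ext s
    simp only [quiet, Set.mem_ofPred_eq, Set.mem_inter_iff, Set.mem_iInter, Set.mem_union]
    refine and_congr_right fun _ => ⟨fun h j => ?_, fun h j hj hcj => ?_⟩
    · exact (le_or_gt _ _).imp_right (h j j.2)
    · exact (h ⟨j, hj⟩).resolve_left (not_le.2 hcj)
  rw [this]
  exact (measurableSet_lt ha (hm N)).inter (MeasurableSet.iInter fun j =>
    (measurableSet_le (hm j) (hcm j)).union (measurableSet_lt ha (hm j)))

lemma measurableSet_quiet (N : ℕ) (c : X → ℝ) (a : ℝ) : MeasurableSet (quiet N c a) :=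
  measurableSet_mem_quiet N (fun x => (measurable_const : Measurable fun _ => c x))
    measurable_const measurable_id

omit [MeasurableSpace X] [DiscreteMeasurableSpace X] in
lemma setLIntegral_sum_rate_Ioi {a : ℝ} (ha : 0 ≤ a) :
    ∫⁻ t in Set.Ioi 0, (∑ x, ENNReal.ofReal (rate x * Real.exp (-((∑ y, rate y) * t)))) *
      (Set.Ioi a).indicator 1 t = ENNReal.ofReal (Real.exp (-((∑ y, rate y) * a))) := by
  rw [lintegral_sum_rate, lintegral_indicator_one measurableSet_Ioi, measure_expMeasure_Ioi ha]

omit hrate [Nonempty X] [MeasurableSpace X] [DiscreteMeasurableSpace X] in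
lemma intensity_sub (c : X → ℝ) (a t : ℝ) :
    intensity rate (fun x => c x - t) (a - t) 0 = intensity rate c a t := by
  refine Finset.sum_congr rfl fun y _ => ?_
  congr 2
  rw [show (0 : ℝ) = t - t by ring, max_sub_sub_right]
  ring

/-- Induction by the first request, at `x` and time `t`: either `t > a`, or `t ≤ c x` and the
restarted process is quiet for the data shifted by `t`. `lintegral_intensity` closes the recursion.
The cap `N` is there because an instance has only finitely many requests. -/
lemma measure_quiet_le (N : ℕ) (c : X → ℝ) {a : ℝ} (ha : 0 ≤ a) :
    modelLaw rate (quiet N c a) ≤ ENNReal.ofReal (Real.exp (-intensity rate c a 0)) := by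
  classical
  induction N generalizing c a with
  | zero =>
    rw [← lintegral_intensity c ha]
    refine le_trans (le_of_eq ?_) le_add_self
    rw [← lintegral_indicator_one (measurableSet_quiet 0 c a), ← setLIntegral_sum_rate_Ioi ha]
    have h := lintegral_step (rate := rate) (G := fun _ t _ => (Set.Ioi a).indicator 1 t)
      fun _ => (measurable_one.indicator measurableSet_Ioi).comp measurable_fst
    simp only [lintegral_const, measure_univ, mul_one, ← Finset.sum_mul] at h
    rw [← h]
    refine lintegral_congr fun w => ?_
    simp [Set.indicator_apply, quiet, firstArr]
  | succ N ih =>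
    set Λ := ∑ y, rate y with hΛ
    set G : X → ℝ → (X → ℕ → ℝ) → ℝ≥0∞ := fun x t w =>
      if c x < t → a < t then (quiet N (fun x => c x - t) (a - t)).indicator 1 w else 0 with hGdef
    have hGm : ∀ x, Measurable (Function.uncurry (G x)) := by
      intro x
      refine Measurable.ite ?_ ?_ measurable_const
      · have : {p : ℝ × (X → ℕ → ℝ) | c x < p.1 → a < p.1} =
            {p : ℝ × (X → ℕ → ℝ) | p.1 ≤ c x} ∪ {p : ℝ × (X → ℕ → ℝ) | a < p.1} := by
          ext p; simp only [Set.mem_ofPred_eq, Set.mem_union, ← not_lt, imp_iff_not_or]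
        rw [this]
        exact (measurableSet_le measurable_fst measurable_const).union
          (measurableSet_lt measurable_const measurable_fst)
      · have := measurable_one.indicator (β := ℝ≥0∞) (measurableSet_mem_quiet
          (S := ℝ × (X → ℕ → ℝ)) N (c := fun x p => c x - p.1) (a := fun p => a - p.1)
          (w := fun p => p.2) (fun x => by fun_prop) (by fun_prop) measurable_snd)
        exact this
    have hGi : ∀ x t, ∫⁻ w, G x t w ∂modelLaw rate =
        if c x < t → a < t then modelLaw rate (quiet N (fun x => c x - t) (a - t)) else 0 := by
      intro x t
      simp only [hGdef]
      split_ifs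
      · exact lintegral_indicator_one (measurableSet_quiet N _ _)
      · exact lintegral_zero
    have h1 : modelLaw rate (quiet (N + 1) c a) =
        ∫⁻ w, G (firstLoc w) (firstArr w) (step w) ∂modelLaw rate := by
      rw [← lintegral_indicator_one (measurableSet_quiet (N + 1) c a)]
      refine lintegral_congr fun w => ?_
      simp only [hGdef, Set.indicator_apply, mem_quiet_succ, ite_and, Pi.one_apply]
    rw [h1, lintegral_step hGm, ← lintegral_intensity c ha, ← setLIntegral_sum_rate_Ioi ha,
      ← lintegral_indicator measurableSet_Ioc]
    set F : ℝ → ℝ≥0∞ := fun t => ENNReal.ofReal ((∑ x, if t ≤ c x then rate x else 0) *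
      Real.exp (-(Λ * t) - intensity rate c a t)) with hF
    calc ∫⁻ t in Set.Ioi 0, ∑ x, ENNReal.ofReal (rate x * Real.exp (-(Λ * t))) *
          ∫⁻ w, G x t w ∂modelLaw rate
        ≤ ∫⁻ t in Set.Ioi 0, ((Set.Ioc 0 a).indicator F t +
            (∑ x, ENNReal.ofReal (rate x * Real.exp (-(Λ * t)))) *
              (Set.Ioi a).indicator 1 t) := by
          refine setLIntegral_mono' measurableSet_Ioi fun t ht => ?_
          simp only [hGi]
          by_cases hta : a < t
          · have h2 : t ∈ Set.Ioi a := hta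
            refine le_trans ?_ le_add_self
            rw [Set.indicator_of_mem h2, Pi.one_apply, mul_one]
            refine Finset.sum_le_sum fun x _ => mul_le_of_le_one_right' ?_
            split_ifs
            exacts [prob_le_one, zero_le_one]
          · have h2 : t ∈ Set.Ioc 0 a := ⟨ht, not_lt.1 hta⟩
            refine le_trans ?_ le_self_add
            rw [Set.indicator_of_mem h2]
            simp only [hF, Finset.sum_mul]
            rw [ENNReal.ofReal_sum_of_nonneg fun x _ => mul_nonneg
              (by split_ifs; exacts [(hrate x).out.le, le_rfl]) (Real.exp_nonneg _)]
            refine Finset.sum_le_sum fun x _ => ?_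
            by_cases hx : t ≤ c x
            · rw [if_pos fun h => absurd hx (not_le.2 h), if_pos hx, sub_eq_add_neg (-(Λ * t)), Real.exp_add,
                ← mul_assoc, ENNReal.ofReal_mul (mul_nonneg (hrate x).out.le (Real.exp_nonneg _)),
                ← intensity_sub]
              gcongr
              exact ih _ (sub_nonneg.2 (not_lt.1 hta))
            · rw [if_neg fun h => hta (h (not_le.1 hx)), mul_zero]
              exact zero_le
      _ = (∫⁻ t in Set.Ioi 0, (Set.Ioc 0 a).indicator F t) +
            ∫⁻ t in Set.Ioi 0, (∑ x, ENNReal.ofReal (rate x * Real.exp (-(Λ * t)))) *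
              (Set.Ioi a).indicator 1 t := by
          rw [lintegral_add_right]
          exact Measurable.mul (by fun_prop) (measurable_one.indicator measurableSet_Ioi)
      _ ≤ _ := by
          gcongr
          exact Measure.restrict_le_self

end Survival
-- Expected costs in terms of the intensity
section Bounds

variable {X : Type*} [MetricSpace X] [Fintype X] [Nonempty X]

omit [MetricSpace X] [Fintype X] [Nonempty X] in
lemma sum_Ioi_fin {M : Type*} [AddCommMonoid M] {m : ℕ} (i : Fin m) (f : ℕ → M) :
    ∑ j ∈ Finset.Ioi i, f j = ∑ k ∈ Finset.range (m - 1 - i), f (i + 1 + k) := by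
  refine Finset.sum_nbij' (fun j => (j : ℕ) - (i + 1))
    (fun k => if h : (i : ℕ) + 1 + k < m then ⟨i + 1 + k, h⟩ else i) ?_ ?_ ?_ ?_ ?_
  · intro j hj
    have h1 : (i : ℕ) < j := Fin.lt_def.1 (Finset.mem_Ioi.1 hj)
    rw [Finset.mem_range]
    omega
  · intro k hk
    rw [Finset.mem_range] at hk
    have h1 : (i : ℕ) + 1 + k < m := by omega
    rw [dif_pos h1, Finset.mem_Ioi]
    exact Fin.lt_def.2 (by simp only; omega)
  · intro j hj
    have h1 : (i : ℕ) < j := Fin.lt_def.1 (Finset.mem_Ioi.1 hj)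
    have h2 : (i : ℕ) + 1 + (j - (i + 1)) = j := by omega
    simp [h2]
  · intro k hk
    rw [Finset.mem_range] at hk
    have h1 : (i : ℕ) + 1 + k < m := by omega
    simp [h1]
  · intro j hj
    have h1 : (i : ℕ) < j := Fin.lt_def.1 (Finset.mem_Ioi.1 hj)
    congr 1
    omega

/-- For a request at `x` and one at `y` a time `s` later: the amounts by which the radii `ρ x` and
`ρ y` exceed the distance of the two requests in space-time. -/
noncomputable def overlap (ρ : X → ℝ) (x y : X) (s : ℝ) : ℝ :=
  max (ρ x - dist x y - s) 0 + max (ρ y - dist x y - s) 0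

variable {rate : X → ℝ} [hrate : ∀ x, Fact (0 < rate x)]
variable [MeasurableSpace X] [DiscreteMeasurableSpace X]

omit [MetricSpace X] in
lemma lintegral_nthLoc (k : ℕ) (f : X → ℝ≥0∞) :
    ∫⁻ w, f (nthLoc w k) ∂modelLaw rate =
      ∑ x, ENNReal.ofReal (rate x / ∑ y, rate y) * f x := by
  rw [lintegral_nthLoc_step k (f := fun x _ => f x) fun _ => measurable_const]
  simp

/-- `sum_radius_le_opt` is integrated; seen from request `k`, the later ones form a fresh process,
to which `lintegral_sum_le` applies. -/
lemma lintegral_opt_ge {m : ℕ} (hm : Even m) {ρ : X → ℝ} (hρ : ∀ x, 0 ≤ ρ x) :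
    (m : ℝ≥0∞) * ∑ x, ENNReal.ofReal (rate x / ∑ y, rate y) * ENNReal.ofReal (ρ x) ≤
      2 * ∫⁻ w, ENNReal.ofReal (opt (firstRequests w m)) ∂modelLaw rate +
        m * ∑ x, ENNReal.ofReal (rate x / ∑ y, rate y) * ∑ y, ENNReal.ofReal (rate y) *
          ∫⁻ s in Set.Ioi 0, ENNReal.ofReal (overlap ρ x y s) := by
  set F : X → ℕ → (X → ℕ → ℝ) → ℝ≥0∞ := fun x n w =>
    ∑ j ∈ Finset.range n, ENNReal.ofReal (overlap ρ x (nthLoc w j) (nthArr w j)) with hF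
  have hom : ∀ x y, Measurable fun s => ENNReal.ofReal (overlap ρ x y s) := fun x y => by
    unfold overlap; fun_prop
  have hFm : ∀ x n, Measurable (F x n) := fun x n =>
    Finset.measurable_fun_sum _ fun j _ => measurable_eval_discrete
      (f := fun y w => ENNReal.ofReal (overlap ρ x y (nthArr w j)))
      (fun y => (hom x y).comp (measurable_nthArr j)) (measurable_nthLoc j)
  have hFkm : ∀ (k n : ℕ), Measurable fun w => F (nthLoc w k) n (step^[k + 1] w) := fun k n =>
    measurable_eval_discrete (f := fun x w => F x n (step^[k + 1] w))
      (fun x => (hFm x n).comp (measurable_step.iterate _)) (measurable_nthLoc k)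
  have hFle : ∀ x n, ∫⁻ w, F x n w ∂modelLaw rate ≤ ∑ y, ENNReal.ofReal (rate y) *
      ∫⁻ s in Set.Ioi 0, ENNReal.ofReal (overlap ρ x y s) := fun x n => lintegral_sum_le n (hom x)
  have hpath : ∀ᵐ w ∂modelLaw rate, ∑ k : Fin m, ENNReal.ofReal (ρ (nthLoc w k)) ≤
      2 * ENNReal.ofReal (opt (firstRequests w m)) +
        ∑ k : Fin m, F (nthLoc w k) (m - 1 - k) (step^[k + 1] w) := by
    filter_upwards [ae_strictMono_nthArr] with w hw
    have h1 := ENNReal.ofReal_le_ofReal (sum_radius_le_opt hm (firstRequests w m) ρ)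
    rw [ENNReal.ofReal_sum_of_nonneg fun k _ => hρ _, ENNReal.ofReal_add, ENNReal.ofReal_mul,
      ENNReal.ofReal_sum_of_nonneg, ENNReal.ofReal_ofNat] at h1
    · refine h1.trans (le_of_eq ?_)
      congr 1
      refine Finset.sum_congr rfl fun i _ => ?_
      rw [ENNReal.ofReal_sum_of_nonneg]
      · set g : ℕ → ℝ≥0∞ := fun j => ENNReal.ofReal
          (overlap ρ (nthLoc w i) (nthLoc w j) (nthArr w j - nthArr w i)) with hg
        have h2 : ∀ j ∈ Finset.Ioi i, ENNReal.ofReal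
            (max (ρ ((firstRequests w m).loc i) - gap (firstRequests w m) i j) 0 +
              max (ρ ((firstRequests w m).loc j) - gap (firstRequests w m) i j) 0) = g j := by
          intro j hj
          have h3 : nthArr w i ≤ nthArr w j :=
            (hw (Fin.lt_def.1 (Finset.mem_Ioi.1 hj))).le
          have h4 : gap (firstRequests w m) i j =
              (nthArr w j - nthArr w i) + dist (nthLoc w i) (nthLoc w j) := by
            rw [← abs_of_nonneg (sub_nonneg.2 h3)]
            rfl
          simp only [hg, overlap, h4, sub_sub, add_comm (nthArr w j - nthArr w i)]
          rfl
        rw [Finset.sum_congr rfl h2, sum_Ioi_fin i g]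
        refine Finset.sum_congr rfl fun j _ => ?_
        simp only [hg]
        rw [nthLoc_add, nthArr_add, add_sub_cancel_left]
      · exact fun j _ => add_nonneg (le_max_right _ _) (le_max_right _ _)
    · exact fun i _ => Finset.sum_nonneg fun j _ =>
        add_nonneg (le_max_right _ _) (le_max_right _ _)
    · exact zero_le_two
    · exact mul_nonneg zero_le_two (opt_nonneg _)
    · exact Finset.sum_nonneg fun i _ => Finset.sum_nonneg fun j _ =>
        add_nonneg (le_max_right _ _) (le_max_right _ _)
  have hint := lintegral_mono_ae hpath
  rw [lintegral_finsetSum _ fun k _ => by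
      exact (Measurable.of_discrete (f := fun x => ENNReal.ofReal (ρ x))).comp
        (measurable_nthLoc k),
    -- Only the overlap sum has to be measurable for this splitting, not `opt`.
    lintegral_add_right _ (Finset.measurable_fun_sum _ fun k _ => hFkm _ _),
    lintegral_const_mul' _ _ ENNReal.ofNat_ne_top,
    lintegral_finsetSum _ fun k _ => hFkm _ _] at hint
  simp only [lintegral_nthLoc _ fun x => ENNReal.ofReal (ρ x), Finset.sum_const, Finset.card_univ,
    Fintype.card_fin, nsmul_eq_mul] at hint
  refine hint.trans ?_
  gcongr
  refine (Finset.sum_le_card_nsmul _ _ (∑ x, ENNReal.ofReal (rate x / ∑ y, rate y) *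
    ∑ y, ENNReal.ofReal (rate y) * ∫⁻ s in Set.Ioi 0, ENNReal.ofReal (overlap ρ x y s))
      fun k _ => ?_).trans (le_of_eq ?_)
  · rw [lintegral_nthLoc_step _ fun x => hFm x _]
    gcongr
    exact hFle _ _
  · rw [Finset.card_univ, Fintype.card_fin, nsmul_eq_mul]

/-- A measurable bound on the cost of Greedy, for all ways of breaking ties, and its expectation. -/
lemma exists_cost_bound (m : ℕ) {D : ℝ} (hD : ∀ x y : X, dist x y ≤ D) :
    ∃ U : (X → ℕ → ℝ) → ℝ≥0∞, Measurable U ∧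
      (∀ᵐ w ∂modelLaw rate, ∀ S, IsGreedy (firstRequests w m) S →
        ENNReal.ofReal (cost (firstRequests w m) S) ≤ U w) ∧
      ∫⁻ w, U w ∂modelLaw rate ≤
        2 * (m * ∑ x, ENNReal.ofReal (rate x / ∑ y, rate y) *
          (∫⁻ a in Set.Ioi 0, ENNReal.ofReal (Real.exp (-intensity rate (dist x) a 0))) +
            ENNReal.ofReal (Fintype.card X * D)) := by
  set Q : X → ℕ → (X → ℕ → ℝ) → ℝ≥0∞ := fun x n w =>
    ∫⁻ a in Set.Ioi 0, {a | w ∈ quiet n (dist x) a}.indicator 1 a with hQ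
  have hjoint : ∀ x n, Measurable fun p : (X → ℕ → ℝ) × ℝ =>
      {a | p.1 ∈ quiet n (dist x) a}.indicator (1 : ℝ → ℝ≥0∞) p.2 := by
    intro x n
    have := measurable_one.indicator (β := ℝ≥0∞) (measurableSet_mem_quiet
      (S := (X → ℕ → ℝ) × ℝ) n (c := fun y _ => dist x y) (a := fun p => p.2)
      (w := fun p => p.1) (fun y => measurable_const) measurable_snd measurable_fst)
    exact this
  have hQm : ∀ x n, Measurable (Q x n) := fun x n => (hjoint x n).lintegral_prod_right'
  have hQkm : ∀ (k n : ℕ), Measurable fun w => Q (nthLoc w k) n (step^[k + 1] w) := fun k n =>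
    measurable_eval_discrete (f := fun x w => Q x n (step^[k + 1] w))
      (fun x => (hQm x n).comp (measurable_step.iterate _)) (measurable_nthLoc k)
  have hQle : ∀ x n, ∫⁻ w, Q x n w ∂modelLaw rate ≤
      ∫⁻ a in Set.Ioi 0, ENNReal.ofReal (Real.exp (-intensity rate (dist x) a 0)) := by
    intro x n
    simp only [hQ]
    rw [lintegral_lintegral_swap (hjoint x n).aemeasurable]
    refine setLIntegral_mono' measurableSet_Ioi fun a ha => ?_
    refine le_trans (le_of_eq ?_) (measure_quiet_le n (dist x) (le_of_lt ha))
    rw [← lintegral_indicator_one (measurableSet_quiet n _ a)]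
    rfl
  -- The last request of the instance has number `m - 2 - k` after the restart at `k`. For `k = m -
  -- 1` the truncated value is 0, and the term is merely an extra nonnegative summand.
  refine ⟨fun w => 2 * (∑ k : Fin m, Q (nthLoc w k) (m - 2 - k) (step^[k + 1] w) +
    ENNReal.ofReal (Fintype.card X * D)), ?_, ?_, ?_⟩
  · exact ((Finset.measurable_fun_sum _ fun k _ => hQkm _ _).add measurable_const).const_mul _
  · filter_upwards [ae_strictMono_nthArr] with w hw S hS
    have hD0 : 0 ≤ D := dist_nonneg.trans (hD (nthLoc w 0) (nthLoc w 0))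
    have hcD : 0 ≤ Fintype.card X * D := mul_nonneg (Nat.cast_nonneg _) hD0
    refine (ENNReal.ofReal_le_ofReal hS.cost_le).trans ?_
    rw [ENNReal.ofReal_mul zero_le_two, ENNReal.ofReal_ofNat]
    gcongr
    rcases Nat.eq_zero_or_pos m with rfl | hm
    · simp [delayCost]
    set l : Fin m := ⟨m - 1, by omega⟩ with hl
    have hmono : StrictMono (firstRequests w m).arr := fun i j hij => hw hij
    refine (ENNReal.ofReal_le_ofReal (hS.delayCost_le (l := l)
      (fun i => hmono.monotone (Fin.le_def.2 (by simp only [hl]; omega))) hD)).trans ?_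
    refine ENNReal.ofReal_add_le.trans ?_
    gcongr
    have hle : ∀ i, (firstRequests w m).arr i ≤ min (S.time i) ((firstRequests w m).arr l) :=
      fun i => le_min (hS.feasible.arr_le_time i)
        (hmono.monotone (Fin.le_def.2 (by simp only [hl]; omega)))
    rw [ENNReal.ofReal_sum_of_nonneg fun i _ => sub_nonneg.2 (hle i)]
    refine Finset.sum_le_sum fun k _ => ?_
    set b := min (S.time k) ((firstRequests w m).arr l) - (firstRequests w m).arr k with hb
    have hsub : Set.Ioo 0 b ⊆ {a | step^[k + 1] w ∈ quiet (m - 2 - k) (dist (nthLoc w k)) a} := by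
      intro a ha
      have hlt := lt_sub_iff_add_lt.1 ha.2
      have hkl : k < l := hmono.lt_iff_lt.1 (by
        have := min_le_right (S.time k) ((firstRequests w m).arr l)
        linarith [ha.1])
      have hkm : (k : ℕ) < m - 1 := Fin.lt_def.1 hkl
      have hshift : ∀ j, nthArr (step^[k + 1] w) j = nthArr w (k + 1 + j) - nthArr w k := by
        intro j
        rw [nthArr_add, add_sub_cancel_left]
      refine ⟨?_, fun j hj hdj => ?_⟩
      · rw [hshift, show (k : ℕ) + 1 + (m - 2 - k) = m - 1 by omega]
        have : min (S.time k) ((firstRequests w m).arr l) ≤ nthArr w (m - 1) := min_le_right _ _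
        have h2 : (firstRequests w m).arr k = nthArr w k := rfl
        linarith
      · rw [hshift] at hdj ⊢
        rw [← nthLoc_add] at hdj
        have := hS.time_le_arr hmono.injective (i := k) (j := ⟨k + 1 + j, by omega⟩) hdj
        have h1 := min_le_left (S.time k) ((firstRequests w m).arr l)
        have h2 : (firstRequests w m).arr k = nthArr w k := rfl
        have h3 : (firstRequests w m).arr ⟨k + 1 + j, by omega⟩ = nthArr w (k + 1 + j) := rfl
        linarith
    calc ENNReal.ofReal b = volume (Set.Ioo 0 b) := by rw [Real.volume_Ioo, sub_zero]
      _ = ∫⁻ a in Set.Ioi 0, (Set.Ioo 0 b).indicator 1 a := by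
          rw [lintegral_indicator_one measurableSet_Ioo, Measure.restrict_apply measurableSet_Ioo]
          congr 1
          exact (Set.inter_eq_left.2 fun a ha => ha.1).symm
      _ ≤ _ := lintegral_mono fun a =>
          Set.indicator_le_indicator_of_subset hsub (fun _ => zero_le) a
  · beta_reduce
    rw [lintegral_const_mul' _ _ ENNReal.ofNat_ne_top,
      lintegral_add_right _ measurable_const, lintegral_const, measure_univ, mul_one,
      lintegral_finsetSum _ fun k _ => hQkm _ _]
    gcongr
    refine (Finset.sum_le_card_nsmul _ _ (∑ x, ENNReal.ofReal (rate x / ∑ y, rate y) *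
      ∫⁻ a in Set.Ioi 0, ENNReal.ofReal (Real.exp (-intensity rate (dist x) a 0)))
        fun k _ => ?_).trans (le_of_eq ?_)
    · rw [lintegral_nthLoc_step _ fun x => hQm x _]
      gcongr
      exact hQle _ _
    · rw [Finset.card_univ, Fintype.card_fin, nsmul_eq_mul]

end Bounds
-- The radius and the numerical constants
section Radius

variable {X : Type*} [MetricSpace X] [Fintype X]

lemma intensity_dist (rate : X → ℝ) (x : X) (a : ℝ) :
    intensity rate (dist x) a 0 = ∑ y, rate y * max (a - dist x y) 0 := by
  simp only [intensity, max_eq_left dist_nonneg]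

variable {rate : X → ℝ} [hrate : ∀ x, Fact (0 < rate x)]

/-- The radius of a ball in space-time in which half a request is expected. -/
lemma exists_radius (x : X) :
    ∃ ρ : ℝ, 0 < ρ ∧ ∑ y, rate y * max (ρ - dist x y) 0 = 1 / 2 := by
  set φ : ℝ → ℝ := fun a => ∑ y, rate y * max (a - dist x y) 0 with hφ
  have hr := (hrate x).out
  have hc : Continuous φ := by fun_prop
  have h0 : φ 0 = 0 := Finset.sum_eq_zero fun y _ => by
    rw [zero_sub, max_eq_right (neg_nonpos.2 dist_nonneg), mul_zero]
  have hb : 0 ≤ 1 / (2 * rate x) := by positivity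
  -- At this argument the term of `x` itself already equals 1/2.
  have h1 : 1 / 2 ≤ φ (1 / (2 * rate x)) := by
    have := Finset.single_le_sum (f := fun y => rate y * max (1 / (2 * rate x) - dist x y) 0)
      (fun y _ => mul_nonneg (hrate y).out.le (le_max_right _ _)) (Finset.mem_univ x)
    refine le_trans (le_of_eq ?_) this
    rw [dist_self, sub_zero, max_eq_left hb]
    field_simp
  obtain ⟨ρ, hρ, hφρ⟩ := intermediate_value_Icc hb hc.continuousOn
    (show (1 / 2 : ℝ) ∈ Set.Icc (φ 0) (φ (1 / (2 * rate x))) from ⟨by rw [h0]; norm_num, h1⟩)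
  refine ⟨ρ, lt_of_le_of_ne hρ.1 ?_, hφρ⟩
  rintro rfl
  rw [h0] at hφρ
  norm_num at hφρ

/-- Up to ρ the integrand is at most 1. Beyond ρ, scaling the cone gives an intensity of at least a
/ (2ρ), and the tail integral is 2ρ exp(-1/2). -/
lemma lintegral_exp_neg_intensity_le {x : X} {ρ : ℝ} (hρ : 0 < ρ)
    (h : ∑ y, rate y * max (ρ - dist x y) 0 = 1 / 2) :
    ∫⁻ a in Set.Ioi 0, ENNReal.ofReal (Real.exp (-intensity rate (dist x) a 0)) ≤
      ENNReal.ofReal (ρ * (1 + 2 * Real.exp (-(1 / 2)))) := by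
  have hI0 : ∀ a, 0 ≤ intensity rate (dist x) a 0 := fun a =>
    Finset.sum_nonneg fun y _ => mul_nonneg (hrate y).out.le (le_max_right _ _)
  have hIle : ∀ a, ρ ≤ a → a / (2 * ρ) ≤ intensity rate (dist x) a 0 := by
    intro a ha
    rw [intensity_dist]
    calc a / (2 * ρ) = a / ρ * ∑ y, rate y * max (ρ - dist x y) 0 := by rw [h]; field_simp
      _ ≤ _ := by
        rw [Finset.mul_sum]
        refine Finset.sum_le_sum fun y _ => ?_
        rw [mul_left_comm]
        refine mul_le_mul_of_nonneg_left ?_ (hrate y).out.le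
        have h1 : 1 ≤ a / ρ := (one_le_div hρ).2 ha
        rw [mul_max_of_nonneg _ _ (by positivity), mul_zero, mul_sub, div_mul_cancel₀ _ hρ.ne']
        exact max_le_max (by nlinarith [dist_nonneg (x := x) (y := y)]) le_rfl
  have hneg : -(1 / (2 * ρ)) < 0 := by
    have : 0 < 1 / (2 * ρ) := by positivity
    linarith
  rw [← Set.Ioc_union_Ioi_eq_Ioi hρ.le, lintegral_union measurableSet_Ioi
    (Set.Ioc_disjoint_Ioi le_rfl), mul_add, mul_one,
    ENNReal.ofReal_add hρ.le (by positivity)]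
  gcongr
  · calc ∫⁻ a in Set.Ioc 0 ρ, ENNReal.ofReal (Real.exp (-intensity rate (dist x) a 0))
        ≤ ∫⁻ a in Set.Ioc 0 ρ, 1 := lintegral_mono fun a => by
          rw [← ENNReal.ofReal_one]
          exact ENNReal.ofReal_le_ofReal (Real.exp_le_one_iff.2 (neg_nonpos.2 (hI0 a)))
      _ = _ := by simp
  · calc ∫⁻ a in Set.Ioi ρ, ENNReal.ofReal (Real.exp (-intensity rate (dist x) a 0))
        ≤ ∫⁻ a in Set.Ioi ρ, ENNReal.ofReal (Real.exp (-(1 / (2 * ρ)) * a)) := by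
          refine setLIntegral_mono' measurableSet_Ioi fun a ha => ?_
          refine ENNReal.ofReal_le_ofReal (Real.exp_le_exp.2 ?_)
          have := hIle a (le_of_lt ha)
          rw [div_eq_mul_one_div] at this
          linarith
      _ = ENNReal.ofReal (∫ a in Set.Ioi ρ, Real.exp (-(1 / (2 * ρ)) * a)) :=
          (ofReal_integral_eq_lintegral_ofReal (integrableOn_exp_mul_Ioi hneg ρ)
            (ae_of_all _ fun a => Real.exp_nonneg _)).symm
      _ ≤ _ := by
          rw [integral_exp_mul_Ioi hneg]
          refine ENNReal.ofReal_le_ofReal (le_of_eq ?_)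
          rw [show -(1 / (2 * ρ)) * ρ = -(1 / 2) by field_simp]
          field_simp

omit [Fintype X] [MetricSpace X] in
lemma lintegral_max_sub_le (b : ℝ) :
    ∫⁻ s in Set.Ioi 0, ENNReal.ofReal (max (b - s) 0) ≤ ENNReal.ofReal (max b 0 ^ 2 / 2) := by
  have hb : 0 ≤ max b 0 := le_max_right _ _
  calc ∫⁻ s in Set.Ioi 0, ENNReal.ofReal (max (b - s) 0)
      = ∫⁻ s in Set.Ioi 0, (Set.Ioc 0 (max b 0)).indicator
          (fun s => ENNReal.ofReal (max b 0 - s)) s := by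
        refine setLIntegral_congr_fun measurableSet_Ioi fun s hs => ?_
        have hs' : 0 < s := hs
        by_cases h : s ≤ max b 0
        · have h1 : s ∈ Set.Ioc 0 (max b 0) := ⟨hs', h⟩
          have h2 : s ≤ b := (le_max_iff.1 h).resolve_right (not_le.2 hs')
          simp only [Set.indicator_of_mem h1]
          rw [max_eq_left (sub_nonneg.2 h2), max_eq_left (hs'.le.trans h2)]
        · have h1 : s ∉ Set.Ioc 0 (max b 0) := fun h' => h h'.2
          simp only [Set.indicator_of_notMem h1]
          rw [max_eq_right (sub_nonpos.2 ((le_max_left _ _).trans (not_le.1 h).le)),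
            ENNReal.ofReal_zero]
    _ ≤ ∫⁻ s in Set.Ioc 0 (max b 0), ENNReal.ofReal (max b 0 - s) := by
        rw [← lintegral_indicator measurableSet_Ioc]
        exact lintegral_mono' Measure.restrict_le_self le_rfl
    _ = ENNReal.ofReal (∫ s in (0)..(max b 0), (max b 0 - s)) := by
        rw [intervalIntegral.integral_of_le hb, ofReal_integral_eq_lintegral_ofReal]
        · exact (Continuous.intervalIntegrable (by fun_prop) _ _).1
        · exact (ae_restrict_iff' measurableSet_Ioc).2 (ae_of_all _ fun s hs => sub_nonneg.2 hs.2)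
    _ ≤ _ := by
        refine ENNReal.ofReal_le_ofReal (le_of_eq ?_)
        rw [intervalIntegral.integral_sub (by simp) (by simp)]
        simp
        ring

/-- Integration over `s` turns each excess `q` into `q ^ 2 / 2`. The weights λ_x λ_y / Λ are
symmetric, so both halves agree. In `q x y ^ 2` one factor is at most `ρ x`, and the other sums to
1/2 by the choice of the radius. -/
lemma sum_lintegral_overlap_le [Nonempty X] {ρ : X → ℝ} (hρ : ∀ x, 0 < ρ x)
    (h : ∀ x, ∑ y, rate y * max (ρ x - dist x y) 0 = 1 / 2) :
    ∑ x, ENNReal.ofReal (rate x / ∑ y, rate y) * ∑ y, ENNReal.ofReal (rate y) *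
      ∫⁻ s in Set.Ioi 0, ENNReal.ofReal (overlap ρ x y s) ≤
        ENNReal.ofReal ((∑ x, rate x / (∑ y, rate y) * ρ x) / 2) := by
  set Λ := ∑ y, rate y with hΛ
  have hΛ0 : 0 < Λ := Finset.sum_pos (fun x _ => (hrate x).out) Finset.univ_nonempty
  set q : X → X → ℝ := fun x y => max (ρ x - dist x y) 0 with hq
  have hq0 : ∀ x y, 0 ≤ q x y := fun x y => le_max_right _ _
  have hov : ∀ x y, ∫⁻ s in Set.Ioi 0, ENNReal.ofReal (overlap ρ x y s) ≤
      ENNReal.ofReal (q x y ^ 2 / 2 + q y x ^ 2 / 2) := by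
    intro x y
    simp only [overlap]
    rw [ENNReal.ofReal_add (by positivity) (by positivity)]
    have : ∀ s, ENNReal.ofReal (max (ρ x - dist x y - s) 0 + max (ρ y - dist x y - s) 0) =
        ENNReal.ofReal (max (ρ x - dist x y - s) 0) +
          ENNReal.ofReal (max (ρ y - dist x y - s) 0) :=
      fun s => ENNReal.ofReal_add (le_max_right _ _) (le_max_right _ _)
    simp only [this]
    rw [lintegral_add_left (by fun_prop)]
    simp only [hq, dist_comm y x]
    exact add_le_add (lintegral_max_sub_le _) (lintegral_max_sub_le _)
  calc _ ≤ ∑ x, ENNReal.ofReal (rate x / Λ) * ∑ y, ENNReal.ofReal (rate y) *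
        ENNReal.ofReal (q x y ^ 2 / 2 + q y x ^ 2 / 2) := by
        gcongr
        exact hov _ _
    _ = ENNReal.ofReal (∑ x, rate x / Λ * ∑ y, rate y * (q x y ^ 2 / 2 + q y x ^ 2 / 2)) := by
        have n1 : ∀ x y, 0 ≤ rate y * (q x y ^ 2 / 2 + q y x ^ 2 / 2) := fun x y =>
          mul_nonneg (hrate y).out.le (by positivity)
        have n2 : ∀ x, 0 ≤ rate x / Λ := fun x => div_nonneg (hrate x).out.le hΛ0.le
        rw [ENNReal.ofReal_sum_of_nonneg fun x _ =>
          mul_nonneg (n2 x) (Finset.sum_nonneg fun y _ => n1 x y)]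
        refine Finset.sum_congr rfl fun x _ => ?_
        rw [ENNReal.ofReal_mul (n2 x), ENNReal.ofReal_sum_of_nonneg fun y _ => n1 x y]
        congr 1
        exact Finset.sum_congr rfl fun y _ => (ENNReal.ofReal_mul (hrate y).out.le).symm
    _ ≤ _ := by
        refine ENNReal.ofReal_le_ofReal ?_
        have e1 : ∑ x, rate x / Λ * ∑ y, rate y * (q x y ^ 2 / 2 + q y x ^ 2 / 2) =
            ∑ x, rate x / Λ * ∑ y, rate y * q x y ^ 2 := by
          have e2 : ∑ x, ∑ y, rate x / Λ * (rate y * (q y x ^ 2 / 2)) =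
              ∑ x, ∑ y, rate x / Λ * (rate y * (q x y ^ 2 / 2)) := by
            rw [Finset.sum_comm]
            exact Finset.sum_congr rfl fun x _ => Finset.sum_congr rfl fun y _ => by ring
          simp only [mul_add, Finset.sum_add_distrib, Finset.mul_sum] at e2 ⊢
          rw [e2, ← Finset.sum_add_distrib]
          refine Finset.sum_congr rfl fun x _ => ?_
          rw [← Finset.sum_add_distrib]
          exact Finset.sum_congr rfl fun y _ => by ring
        rw [e1, Finset.sum_div]
        refine Finset.sum_le_sum fun x _ => ?_
        rw [mul_div_assoc]
        refine mul_le_mul_of_nonneg_left ?_ (div_nonneg (hrate x).out.le hΛ0.le)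
        calc ∑ y, rate y * q x y ^ 2 ≤ ∑ y, ρ x * (rate y * q x y) := by
              refine Finset.sum_le_sum fun y _ => ?_
              have h1 : q x y ≤ ρ x := max_le (by linarith [dist_nonneg (x := x) (y := y)]) (hρ x).le
              have h2 := mul_nonneg (hrate y).out.le (hq0 x y)
              nlinarith
          _ = ρ x / 2 := by rw [← Finset.mul_sum, h x]; ring

lemma ratio_const_le : 8 * (1 + 2 * Real.exp (-(1 / 2))) ≤ 16 / (1 - Real.exp (-2)) := by
  have hq0 := Real.exp_pos (-(1 / 2) : ℝ)
  have h1 : Real.exp (-(1 / 2)) ^ 2 = Real.exp (-1) := by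
    rw [← Real.exp_nat_mul]; norm_num
  have h2 : Real.exp (-1) ^ 2 = Real.exp (-2) := by
    rw [← Real.exp_nat_mul]; norm_num
  have hlt := Real.exp_neg_one_lt_d9
  have hgt := Real.exp_neg_one_gt_d9
  have hq : Real.exp (-(1 / 2)) ≤ 0.61 := by nlinarith
  have h3 : 0.13 ≤ Real.exp (-2) := by nlinarith
  have h4 : Real.exp (-2) < 1 := Real.exp_lt_one_iff.2 (by norm_num)
  rw [le_div_iff₀ (by linarith)]
  nlinarith

end Radius
-- Comparison of the two expectations
section Ratio

variable {X : Type*} [MetricSpace X] [Finite X] [Nonempty X]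
  {Ω : Type*} [MeasurableSpace Ω] {P : Measure Ω} {rate : X → ℝ} {W : X → ℕ → Ω → ℝ}

omit [MetricSpace X] [Finite X] [Nonempty X] in
lemma IsPoissonModel.measurable_waits (hW : IsPoissonModel P rate W) :
    Measurable fun ω x j => W x j ω :=
  measurable_pi_iff.2 fun x => measurable_pi_iff.2 fun j => hW.measurable x j

/-- The optimal cost is asymptotically at least `R / 4` per request and the cost of Greedy at most
`2 * (1 + 2 * exp (-1 / 2)) * R`, where `R` is the mean radius at the location of a request. -/
lemma IsPoissonModel.exists_bounds (hW : IsPoissonModel P rate W) :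
    ∃ R C : ℝ, 0 < R ∧ 0 ≤ C ∧
      (∀ m : ℕ, Even m → ENNReal.ofReal (m * R / 4) ≤ expOpt P W m) ∧
      ∀ m : ℕ, ∀ S : Ω → Solution m, (∀ᵐ ω ∂P, IsGreedy (randomRequests W m ω) (S ω)) →
        expCost P W S ≤
          ENNReal.ofReal (2 * (m * (R * (1 + 2 * Real.exp (-(1 / 2)))) + C)) := by
  have := Fintype.ofFinite X
  let _ : MeasurableSpace X := ⊤
  have : DiscreteMeasurableSpace X := ⟨fun _ => trivial⟩
  have hfact : ∀ x, Fact (0 < rate x) := fun x => ⟨hW.rate_pos x⟩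
  set Λ := ∑ y, rate y with hΛ
  have hΛ0 : 0 < Λ := Finset.sum_pos (fun x _ => hW.rate_pos x) Finset.univ_nonempty
  set κ := 1 + 2 * Real.exp (-(1 / 2)) with hκ
  have hκ0 : 0 < κ := by positivity
  choose ρ hρ hρ2 using fun x => exists_radius (rate := rate) x
  set R := ∑ x, rate x / Λ * ρ x with hR
  have hp : ∀ x, 0 < rate x / Λ := fun x => div_pos (hW.rate_pos x) hΛ0
  have hR0 : 0 < R := Finset.sum_pos (fun x _ => mul_pos (hp x) (hρ x)) Finset.univ_nonempty
  obtain ⟨D, hD⟩ := (Set.finite_range fun p : X × X => dist p.1 p.2).bddAbove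
  have hD' : ∀ x y : X, dist x y ≤ D := fun x y => hD ⟨(x, y), rfl⟩
  have hD0 : 0 ≤ D := dist_nonneg.trans (hD' (Classical.arbitrary X) (Classical.arbitrary X))
  have hmap := hW.map_eq
  have hwm := hW.measurable_waits
  have hsum : ∑ x, ENNReal.ofReal (rate x / Λ) * ENNReal.ofReal (ρ x) = ENNReal.ofReal R := by
    rw [hR, ENNReal.ofReal_sum_of_nonneg fun x _ => (mul_pos (hp x) (hρ x)).le]
    exact Finset.sum_congr rfl fun x _ => (ENNReal.ofReal_mul (hp x).le).symm
  refine ⟨R, Fintype.card X * D, hR0, by positivity, fun m hm => ?_, fun m S hS => ?_⟩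
  · have h1 := lintegral_opt_ge (rate := rate) hm fun x => (hρ x).le
    rw [hsum] at h1
    have h2 : ∫⁻ w, ENNReal.ofReal (opt (firstRequests w m)) ∂modelLaw rate ≤ expOpt P W m := by
      rw [← hmap]
      -- Without measurability of `opt`, passing to the image measure gives only an inequality, in
      -- the direction needed here.
      exact lintegral_map_le _ _
    have h3 : ENNReal.ofReal (m * R / 2) + ENNReal.ofReal (m * R / 2) ≤
        2 * expOpt P W m + ENNReal.ofReal (m * R / 2) := by
      rw [← ENNReal.ofReal_add (by positivity) (by positivity), add_halves,
        ENNReal.ofReal_mul (Nat.cast_nonneg _), ENNReal.ofReal_natCast, mul_div_assoc,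
        ENNReal.ofReal_mul (Nat.cast_nonneg _), ENNReal.ofReal_natCast]
      refine h1.trans ?_
      gcongr
      exact sum_lintegral_overlap_le hρ hρ2
    have h4 := ENNReal.le_of_add_le_add_right ENNReal.ofReal_ne_top h3
    rw [show (m : ℝ) * R / 2 = 2 * (m * R / 4) by ring, ENNReal.ofReal_mul zero_le_two,
      ENNReal.ofReal_ofNat] at h4
    exact (ENNReal.mul_le_mul_iff_right two_ne_zero ENNReal.ofNat_ne_top).1 h4
  · obtain ⟨U, hUm, hU, hUint⟩ := exists_cost_bound (rate := rate) m hD'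
    rw [← hmap] at hU hUint
    have hU' := ae_of_ae_map hwm.aemeasurable hU
    calc expCost P W S ≤ ∫⁻ ω, U (fun x j => W x j ω) ∂P := by
          refine lintegral_mono_ae ?_
          filter_upwards [hU', hS] with ω h1 h2
          exact h1 _ h2
      _ = ∫⁻ w, U w ∂P.map fun ω x j => W x j ω := (lintegral_map hUm hwm).symm
      _ ≤ _ := hUint
      _ ≤ 2 * (m * ∑ x, ENNReal.ofReal (rate x / Λ) * ENNReal.ofReal (ρ x * κ) +
            ENNReal.ofReal (Fintype.card X * D)) := by
          gcongr with x
          exact lintegral_exp_neg_intensity_le (hρ x) (hρ2 x)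
      _ = _ := by
          have : ∑ x, ENNReal.ofReal (rate x / Λ) * ENNReal.ofReal (ρ x * κ) =
              ENNReal.ofReal (R * κ) := by
            rw [ENNReal.ofReal_mul hR0.le, ← hsum, Finset.sum_mul]
            exact Finset.sum_congr rfl fun x _ => by
              rw [ENNReal.ofReal_mul (hρ x).le, mul_assoc]
          rw [this, ENNReal.ofReal_mul zero_le_two, ENNReal.ofReal_ofNat,
            ENNReal.ofReal_add (by positivity) (by positivity),
            ENNReal.ofReal_mul (Nat.cast_nonneg m), ENNReal.ofReal_natCast]

lemma expOpt_le_expCost {m : ℕ} {S : Ω → Solution m}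
    (hS : ∀ᵐ ω ∂P, IsGreedy (randomRequests W m ω) (S ω)) : expOpt P W m ≤ expCost P W S := by
  refine lintegral_mono_ae ?_
  filter_upwards [hS] with ω h
  exact ENNReal.ofReal_le_ofReal (opt_le_cost h.feasible)

end Ratio

end MPMD

theorem theorem1 {X : Type*} [MetricSpace X] [Finite X] [Nonempty X]
    {Ω : Type*} [MeasurableSpace Ω] (P : Measure Ω) [IsProbabilityMeasure P]
    (rate : X → ℝ) (W : X → ℕ → Ω → ℝ) (hW : MPMD.IsPoissonModel P rate W)
    (greedy : (n : ℕ) → Ω → MPMD.Solution (2 * n))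
    (hgreedy : ∀ n, ∀ᵐ ω ∂P, MPMD.IsGreedy (MPMD.randomRequests W (2 * n) ω) (greedy n ω)) :
    (∀ n, 0 < n → 0 < MPMD.expOpt P W (2 * n) ∧ MPMD.expOpt P W (2 * n) < ∞ ∧
      MPMD.expCost P W (greedy n) < ∞) ∧
    limsup (fun n : ℕ => MPMD.expCost P W (greedy n) / MPMD.expOpt P W (2 * n)) atTop ≤
      ENNReal.ofReal (16 / (1 - Real.exp (-2))) := by
  obtain ⟨R, C, hR, hC, hopt, hcost⟩ := hW.exists_bounds
  have hfin : ∀ n, MPMD.expCost P W (greedy n) < ∞ := fun n =>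
    (hcost _ _ (hgreedy n)).trans_lt ENNReal.ofReal_lt_top
  refine ⟨fun n hn => ⟨?_, (MPMD.expOpt_le_expCost (hgreedy n)).trans_lt (hfin n), hfin n⟩, ?_⟩
  · refine lt_of_lt_of_le (ENNReal.ofReal_pos.2 ?_) (hopt (2 * n) (even_two_mul n))
    have : (0 : ℝ) < (2 * n : ℕ) := by exact_mod_cast Nat.mul_pos two_pos hn
    positivity
  · set κ := 1 + 2 * Real.exp (-(1 / 2)) with hκ
    -- For `m = 2 * n` the quotient of the two bounds is exactly this sequence.
    have hlim : Tendsto (fun n : ℕ => ENNReal.ofReal (8 * κ + 4 * C / R / n)) atTop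
        (nhds (ENNReal.ofReal (8 * κ))) := by
      refine ENNReal.tendsto_ofReal ?_
      simpa using (tendsto_const_div_atTop_nhds_zero_nat (4 * C / R)).const_add (8 * κ)
    refine le_trans ?_ (ENNReal.ofReal_le_ofReal MPMD.ratio_const_le)
    rw [← hlim.limsup_eq]
    refine limsup_le_limsup ?_
    filter_upwards [eventually_gt_atTop 0] with n hn
    have hn' : (0 : ℝ) < n := by exact_mod_cast hn
    refine (ENNReal.div_le_div (hcost _ _ (hgreedy n)) (hopt _ (even_two_mul n))).trans ?_
    push_cast
    rw [← ENNReal.ofReal_div_of_pos (by positivity)]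
    refine ENNReal.ofReal_le_ofReal (le_of_eq ?_)
    field_simp
    ring
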